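/- Conventions. Let $\top$ be the category of $\Delta$-generated spaces, or that of $\Delta$-Hausdorff $\Delta$-generated spaces. Let $\mathcal P\in\{\mathcal G,\mathcal M\}$, where $\mathcal G(1,1)$ is the set of nondecreasing homeomorphisms of $[0,1]$ and $\mathcal M(1,1)$ the set of nondecreasing continuous surjections of $[0,1]$ onto itself. A $\mathcal P$-multipointed $d$-space $X$ is a triple $(|X|,X^0,\mathbb P^{top}X)$ consisting of a space $|X|$ of $\top$, a subset $X^0\subset|X|$ of states, and a set $\mathbb P^{top}X$ of continuous maps $[0,1]\to|X|$ (the execution paths) whose extremities are states and which is stable under precomposition by elements of $\mathcal P(1,1)$ and under normalized composition (concatenation at double speed) of composable paths; maps are the continuous maps preserving states and execution paths. For $\alpha,\beta\in X^0$, $\mathbb P^{top}_{\alpha,\beta}X$ is the set of execution paths from $\alpha$ to $\beta$ equipped with the $\Delta$-kelleyfication of the relative topology induced by the inclusion in the internal hom $\mathbf{TOP}([0,1],|X|)$, i.e. in the set of continuous maps with the $\Delta$-kelleyfication of the compact-open topology. The globe $\mathrm{Glob}^{\mathcal P}(Z)$ has as underlying space the quotient of $\{0,1\}\sqcup(Z\times[0,1])$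 by $(z,0)=0$ and $(z,1)=1$ for all $z\in Z$, as states $0$ and $1$, and as execution paths the maps $\delta_z\phi$ with $z\in Z$ and $\phi\in\mathcal P(1,1)$, where $\delta_z(t)=(z,t)$. A cellular $\mathcal P$-multipointed $d$-space is a $\mathcal P$-multipointed $d$-space $X_\lambda$ which is the last term of a tower $(X_\nu)_{\nu\le\lambda}$, $\lambda$ an ordinal, where $X_0=(X^0,X^0,\varnothing)$ is a (discrete) set, $X_\nu$ is the colimit of the $X_\mu$ with $\mu<\nu$ for each limit ordinal $\nu\le\lambda$, and, for each $\nu<\lambda$, $X_{\nu+1}$ is the pushout of $\mathrm{Glob}^{\mathcal P}(\mathbf S^{n_\nu-1})\subset\mathrm{Glob}^{\mathcal P}(\mathbf D^{n_\nu})$ along a map $g_\nu:\mathrm{Glob}^{\mathcal P}(\mathbf S^{n_\nu-1})\to X_\nu$, with $n_\nu\ge0$. Write $\widehat{g_\nu}:\mathrm{Glob}^{\mathcal P}(\mathbf D^{n_\nu})\to X_\lambda$ for the resulting map and $c_\nu$ for the $\nu$-th globular cell. If an execution path $\gamma$ of $X_\lambda$ is written as a Moore composition $$\gamma=(\widehat{g_{\nu_1}}\delta_{z_1}\phi_1\mu_{\ell_1})*\dots*(\widehat{g_{\nu_n}}\delta_{z_n}\phi_n\mu_{\ell_n})$$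 with $n\ge1$, $\nu_i<\lambda$, $z_i\in\mathbf D^{n_{\nu_i}}\setminus\mathbf S^{n_{\nu_i}-1}$, $\phi_i\in\mathcal P(1,1)$, $\ell_i>0$, $\ell_1+\dots+\ell_n=1$ and $\mu_\ell:[0,\ell]\to[0,1]$, $t\mapsto t/\ell$, then the finite sequence $[c_{\nu_1},\dots,c_{\nu_n}]$ is called the carrier of $\gamma$, denoted by $\mathrm{Carrier}(\gamma)$, and $n$ its natural length. Theorem. Let $X_\lambda$ be a cellular $\mathcal P$-multipointed $d$-space, let $(\alpha,\beta)\in X^0\times X^0$, and let $\psi:[0,1]\to\mathbb P^{top}_{\alpha,\beta}X_\lambda$ be a continuous map. Then each $\psi(u)$ has exactly one carrier, the set $\{\mathrm{Carrier}(\psi(u))\mid u\in[0,1]\}$ is finite, and the set of natural lengths of $\psi(u)$, for $u$ running over $[0,1]$, is bounded. -/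

import Mathlib

open CategoryTheory Topology Set
open scoped unitInterval

universe u

noncomputable section

/-- The two admissible conventions for the category `⊤` of spaces: Δ-generated spaces, or
Δ-Hausdorff Δ-generated spaces. -/
inductive SpaceConvention
  | deltaGenerated
  | deltaHausdorff

/-- The two reparametrization categories `𝒢` and `ℳ`. -/
inductive ReparamKind
  | G
  | M

/-- A space is Δ-Hausdorff if the image of every continuous map from `[0,1]` is closed. -/
def IsDeltaHausdorff (Y : Type*) [TopologicalSpace Y] : Prop :=
  ∀ φ : C(I, Y), IsClosed (range φ)

/-- Membership in `𝒫(1,1)`: nondecreasing homeomorphisms of `[0,1]` for `𝒢`, nondecreasing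
continuous surjections of `[0,1]` for `ℳ`. -/
def ReparamKind.Mem : ReparamKind → C(I, I) → Prop
  | .G, φ => Monotone φ ∧ IsHomeomorph φ
  | .M, φ => Monotone φ ∧ Function.Surjective φ

theorem ReparamKind.Mem.comp {P : ReparamKind} {φ φ' : C(I, I)} (h : P.Mem φ) (h' : P.Mem φ') :
    P.Mem (φ.comp φ') := by
  cases P
  · exact ⟨h.1.comp h'.1, h.2.comp h'.2⟩
  · exact ⟨h.1.comp h'.1, h.2.comp h'.2⟩

theorem ReparamKind.Mem.surjective {P : ReparamKind} {φ : C(I, I)} (h : P.Mem φ) :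
    Function.Surjective φ := by
  cases P
  · exact h.2.surjective
  · exact h.2

theorem ReparamKind.Mem.monotone {P : ReparamKind} {φ : C(I, I)} (h : P.Mem φ) :
    Monotone φ := by
  cases P
  · exact h.1
  · exact h.1

theorem ReparamKind.Mem.map_zero {P : ReparamKind} {φ : C(I, I)} (h : P.Mem φ) : φ 0 = 0 := by
  obtain ⟨t, ht⟩ := h.surjective 0
  exact le_antisymm ((h.monotone (show (0 : I) ≤ t from t.2.1)).trans_eq ht) (φ 0).2.1

theorem ReparamKind.Mem.map_one {P : ReparamKind} {φ : C(I, I)} (h : P.Mem φ) : φ 1 = 1 := by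
  obtain ⟨t, ht⟩ := h.surjective 1
  exact le_antisymm (φ 1).2.2 (ht.symm.trans_le (h.monotone (show t ≤ (1 : I) from t.2.2)))

/-- The normalized composition of two composable continuous paths parametrized by `[0,1]`: run
through `γ₁` on `[0,1/2]` and through `γ₂` on `[1/2,1]`, both at double speed. -/
def normComp {Y : Type*} [TopologicalSpace Y] (γ₁ γ₂ : C(I, Y)) (h : γ₁ 1 = γ₂ 0) : C(I, Y) :=
  (Path.trans (⟨γ₁, rfl, h⟩ : Path (γ₁ 0) (γ₂ 0)) ⟨γ₂, rfl, rfl⟩).toContinuousMap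

/-- A `𝒫`-multipointed `d`-space: a space of `⊤`, a set of states, and a set of execution paths
with extremities among the states, stable by the reparametrizations of `𝒫(1,1)` and by normalized
composition. -/
structure MDSpace (T : SpaceConvention) (P : ReparamKind) : Type (u + 1) where
  carrier : Type u
  [top : TopologicalSpace carrier]
  [delta : DeltaGeneratedSpace carrier]
  hausdorff : T = .deltaHausdorff → IsDeltaHausdorff carrier
  states : Set carrier
  paths : Set C(I, carrier)
  source_mem : ∀ γ ∈ paths, γ 0 ∈ states
  target_mem : ∀ γ ∈ paths, γ 1 ∈ states
  reparam_mem : ∀ γ ∈ paths, ∀ φ : C(I, I), P.Mem φ → γ.comp φ ∈ paths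
  normComp_mem : ∀ γ₁ ∈ paths, ∀ γ₂ ∈ paths, ∀ h : γ₁ 1 = γ₂ 0, normComp γ₁ γ₂ h ∈ paths

attribute [instance] MDSpace.top MDSpace.delta

namespace MDSpace

variable {T : SpaceConvention} {P : ReparamKind}

instance : CoeSort (MDSpace.{u} T P) (Type u) := ⟨MDSpace.carrier⟩

/-- A map of `𝒫`-multipointed `d`-spaces: a continuous map which preserves states and execution
paths. -/
@[ext]
structure Hom (X Y : MDSpace.{u} T P) : Type u where
  map : C(X, Y)
  map_states : ∀ x ∈ X.states, map x ∈ Y.states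
  map_paths : ∀ γ ∈ X.paths, map.comp γ ∈ Y.paths

instance : Category (MDSpace.{u} T P) where
  Hom := Hom
  id X := ⟨ContinuousMap.id X, fun _ h => h, fun _ h => h⟩
  comp f g := ⟨g.map.comp f.map, fun x h => g.map_states _ (f.map_states x h),
    fun γ h => g.map_paths _ (f.map_paths γ h)⟩

/-- `X` is a set `E`, seen as the `𝒫`-multipointed `d`-space `(E, E, ∅)`. -/
def IsSet (X : MDSpace.{u} T P) : Prop :=
  DiscreteTopology X ∧ X.states = univ ∧ X.paths = ∅

/-- The set of execution paths of `X` from `α` to `β`. -/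
def PathSpace (X : MDSpace.{u} T P) (α β : X.states) : Type u :=
  {γ : C(I, X) // γ ∈ X.paths ∧ γ 0 = α ∧ γ 1 = β}

/-- The continuous map from `[0,1]` underlying an execution path from `α` to `β`. -/
def PathSpace.path {X : MDSpace.{u} T P} {α β : X.states} (γ : X.PathSpace α β) : C(I, X) := γ.1

/-- The topology of the space of execution paths from `α` to `β`: the Δ-kelleyfication of the
relative topology induced by the inclusion into the internal hom `TOP([0,1], X)`, which is the set
of continuous maps equipped with the Δ-kelleyfication of the compact-open topology. -/
instance (X : MDSpace.{u} T P) (α β : X.states) : TopologicalSpace (X.PathSpace α β) :=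
  @TopologicalSpace.generatedBy _ (fun n : ℕ => Fin n → ℝ) _ _
    (TopologicalSpace.induced
      (fun γ : X.PathSpace α β =>
        (WithGeneratedByTopology.equiv.symm γ.path : DeltaGeneratedSpace.of (Y := C(I, X))))
      inferInstance)

end MDSpace

/-! ### Globes -/

/-- The identifications defining the globe of `Z`: all the points `(z, 0)` are identified with the
state `0` (here `false`), and all the points `(z, 1)` with the state `1` (here `true`). -/
inductive GlobeRel (Z : Type u) [TopologicalSpace Z] :
    Bool ⊕ DeltaGeneratedSpace.of (Y := Z × I) → Bool ⊕ DeltaGeneratedSpace.of (Y := Z × I) → Prop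
  | zero (z : Z) : GlobeRel Z (.inr (WithGeneratedByTopology.equiv.symm (z, 0))) (.inl false)
  | one (z : Z) : GlobeRel Z (.inr (WithGeneratedByTopology.equiv.symm (z, 1))) (.inl true)

/-- The underlying space of the globe of `Z`: the quotient of `{0,1} ⊔ (Z × [0,1])`, the product
being that of the category of Δ-generated spaces. -/
def GlobeSpace (Z : Type u) [TopologicalSpace Z] : Type u := Quot (GlobeRel Z)

namespace GlobeSpace

variable (Z : Type u) [TopologicalSpace Z]

instance : TopologicalSpace (GlobeSpace Z) := inferInstanceAs (TopologicalSpace (Quot _))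

instance : DeltaGeneratedSpace Bool := by
  refine IsGeneratedBy.iff_le_generatedBy.2 ?_
  rw [DiscreteTopology.eq_bot (α := Bool)]
  exact bot_le

instance : DeltaGeneratedSpace (GlobeSpace Z) :=
  inferInstanceAs (DeltaGeneratedSpace (Quot (GlobeRel Z)))

variable {Z}

/-- The states `0` (`false`) and `1` (`true`) of the globe. -/
def state (b : Bool) : GlobeSpace Z := Quot.mk _ (.inl b)

/-- The image in the globe of a point `(z, t)` of `Z × [0,1]`. -/
def point (z : Z) (t : I) : GlobeSpace Z :=
  Quot.mk _ (.inr (WithGeneratedByTopology.equiv.symm (z, t)))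

theorem point_zero (z : Z) : point z 0 = state false := Quot.sound (.zero z)

theorem point_one (z : Z) : point z 1 = state true := Quot.sound (.one z)

instance : DeltaGeneratedSpace I :=
  ((isQuotientMap_projIcc (h := zero_le_one (α := ℝ))).comp
    (Homeomorph.funUnique (Fin 1) ℝ).isQuotientMap).isGeneratedBy

theorem continuous_point (z : Z) : Continuous (point z) := by
  have h1 : Continuous (WithGeneratedByTopology.equiv.symm ∘ fun t : I => (z, t) :
      I → DeltaGeneratedSpace.of (Y := Z × I)) :=
    (IsGeneratedBy.equiv_symm_comp_continuous_iff (X := fun n : ℕ => Fin n → ℝ) _).2 (by fun_prop)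
  exact continuous_quot_mk.comp (continuous_inr.comp h1)

/-- The directed path `δ_z : t ↦ (z, t)` of the globe. -/
def delta (z : Z) : C(I, GlobeSpace Z) := ⟨point z, continuous_point z⟩

/-- Descent of a map from `{0,1} ⊔ (Z × [0,1])` to the globe. -/
def desc {Y : Type*} (s : Bool → Y) (f : Z × I → Y)
    (h0 : ∀ z, f (z, 0) = s false) (h1 : ∀ z, f (z, 1) = s true) : GlobeSpace Z → Y :=
  Quot.lift (Sum.elim s (f ∘ WithGeneratedByTopology.equiv)) (by
    rintro _ _ (z | z)
    · exact h0 z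
    · exact h1 z)

theorem continuous_desc {Y : Type*} [TopologicalSpace Y] {s : Bool → Y} {f : Z × I → Y}
    (h0 : ∀ z, f (z, 0) = s false) (h1 : ∀ z, f (z, 1) = s true)
    (hf : Continuous (f ∘ WithGeneratedByTopology.equiv :
      DeltaGeneratedSpace.of (Y := Z × I) → Y)) : Continuous (desc s f h0 h1) :=
  continuous_quot_lift _ (continuous_of_discreteTopology.sumElim hf)

/-- The projection of the globe to `[0,1]`. -/
def height : GlobeSpace Z → I :=
  desc (fun b => if b then 1 else 0) Prod.snd (fun _ => rfl) (fun _ => rfl)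

theorem continuous_height : Continuous (height (Z := Z)) :=
  continuous_desc _ _ (by fun_prop)

@[simp] theorem height_point (z : Z) (t : I) : height (point z t) = t := rfl
@[simp] theorem height_false : height (state false : GlobeSpace Z) = 0 := rfl
@[simp] theorem height_true : height (state true : GlobeSpace Z) = 1 := rfl

theorem cases (x : GlobeSpace Z) :
    x = state false ∨ x = state true ∨ ∃ z t, t ≠ 0 ∧ t ≠ 1 ∧ x = point z t := by
  obtain ⟨y, rfl⟩ := Quot.exists_rep x
  rcases y with (b | y)
  · cases b
    · exact Or.inl rfl
    · exact Or.inr (Or.inl rfl)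
  · obtain ⟨⟨z, t⟩, rfl⟩ := (WithGeneratedByTopology.equiv (X := fun n : ℕ => Fin n → ℝ)
      (Y := Z × I)).symm.surjective y
    change point z t = _ ∨ point z t = _ ∨ ∃ z' t', _ ∧ _ ∧ point z t = _
    by_cases h0 : t = 0
    · subst h0; exact Or.inl (point_zero z)
    by_cases h1 : t = 1
    · subst h1; exact Or.inr (Or.inl (point_one z))
    exact Or.inr (Or.inr ⟨z, t, h0, h1, rfl⟩)

/-- Those points `(z, t)` of the globe with `0 < t < 1` and `z ∈ U`. -/
def overOpen (U : Set Z) : Set (GlobeSpace Z) :=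
  {x | desc (fun _ => False) (fun p => p.1 ∈ U ∧ p.2 ≠ 0 ∧ p.2 ≠ 1) (by simp) (by simp) x}

theorem isOpen_overOpen {U : Set Z} (hU : IsOpen U) : IsOpen (overOpen U) := by
  refine (isQuotientMap_quot_mk (r := GlobeRel Z)).isOpen_preimage.1 (isOpen_sum_iff.2 ?_)
  constructor
  · exact isOpen_discrete _
  · have hO : IsOpen {p : Z × I | p.1 ∈ U ∧ p.2 ≠ 0 ∧ p.2 ≠ 1} :=
      (hU.preimage continuous_fst).inter
        ((isOpen_ne.preimage continuous_snd).inter (isOpen_ne.preimage continuous_snd))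
    exact hO.preimage (WithGeneratedByTopology.continuous_equiv (X := fun n : ℕ => Fin n → ℝ))

instance [T2Space Z] : T2Space (GlobeSpace Z) := by
  refine ⟨fun x y hxy => ?_⟩
  by_cases h : height x = height y
  · rcases cases x with rfl | rfl | ⟨z, t, h0, h1, rfl⟩ <;>
      rcases cases y with rfl | rfl | ⟨z', t', h0', h1', rfl⟩ <;>
      simp_all [eq_comm]
    have hz : z ≠ z' := fun e => hxy (by rw [e])
    obtain ⟨U, V, hU, hV, hzU, hzV, hd⟩ := t2_separation hz
    refine ⟨overOpen U, isOpen_overOpen hU, overOpen V, isOpen_overOpen hV, ⟨hzU, h0', h1'⟩,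
      ⟨hzV, h0', h1'⟩, ?_⟩
    rw [Set.disjoint_left]
    intro w hw hw'
    rcases cases w with rfl | rfl | ⟨a, s, _, _, rfl⟩
    · exact hw
    · exact hw
    · exact Set.disjoint_left.1 hd hw.1 hw'.1
  · obtain ⟨U, V, hU, hV, hxU, hyV, hd⟩ := t2_separation h
    exact ⟨_, _, hU.preimage continuous_height, hV.preimage continuous_height, hxU, hyV,
      hd.preimage _⟩

/-- The map of globes induced by a continuous map. -/
def map {Z' : Type u} [TopologicalSpace Z'] (f : C(Z, Z')) : C(GlobeSpace Z, GlobeSpace Z') where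
  toFun := desc state (fun p => point (f p.1) p.2) (fun _ => point_zero _) (fun _ => point_one _)
  continuous_toFun := by
    refine continuous_desc _ _ (continuous_quot_mk.comp (continuous_inr.comp ?_))
    change Continuous (WithGeneratedByTopology.equiv.symm ∘
      (fun y : DeltaGeneratedSpace.of (Y := Z × I) =>
        (f (WithGeneratedByTopology.equiv y).1, (WithGeneratedByTopology.equiv y).2)))
    exact (IsGeneratedBy.equiv_symm_comp_continuous_iff (X := fun n : ℕ => Fin n → ℝ) _).2 (by fun_prop)

end GlobeSpace

/-- The topological globe of a Hausdorff space `Z`: its states are `0` and `1`, and its execution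
paths are the `δ_z φ` with `z ∈ Z` and `φ ∈ 𝒫(1,1)`. -/
def globe (T : SpaceConvention) (P : ReparamKind) (Z : Type u) [TopologicalSpace Z] [T2Space Z] :
    MDSpace.{u} T P where
  carrier := GlobeSpace Z
  hausdorff _ φ := (isCompact_range φ.continuous).isClosed
  states := range GlobeSpace.state
  paths := {γ | ∃ z : Z, ∃ φ : C(I, I), P.Mem φ ∧ γ = (GlobeSpace.delta z).comp φ}
  source_mem := by
    rintro _ ⟨z, φ, hφ, rfl⟩
    exact ⟨false, by
      simpa [hφ.map_zero, GlobeSpace.delta] using (GlobeSpace.point_zero z).symm⟩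
  target_mem := by
    rintro _ ⟨z, φ, hφ, rfl⟩
    exact ⟨true, by
      simpa [hφ.map_one, GlobeSpace.delta] using (GlobeSpace.point_one z).symm⟩
  reparam_mem := by
    rintro _ ⟨z, φ, hφ, rfl⟩ φ' hφ'
    exact ⟨z, φ.comp φ', hφ.comp hφ', rfl⟩
  normComp_mem := by
    rintro _ ⟨z, φ, hφ, rfl⟩ _ ⟨z', φ', hφ', rfl⟩ h
    have := congrArg GlobeSpace.height h
    simp [GlobeSpace.delta, hφ.map_one, hφ'.map_zero] at this

/-- The map of multipointed `d`-spaces between globes induced by a continuous map. -/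
def globeMap (T : SpaceConvention) (P : ReparamKind) {Z Z' : Type u} [TopologicalSpace Z]
    [TopologicalSpace Z'] [T2Space Z] [T2Space Z'] (f : C(Z, Z')) :
    globe T P Z ⟶ globe T P Z' where
  map := GlobeSpace.map f
  map_states := by
    rintro _ ⟨b, rfl⟩
    exact ⟨b, rfl⟩
  map_paths := by
    rintro _ ⟨z, φ, hφ, rfl⟩
    exact ⟨f z, φ, hφ, rfl⟩

instance (n : ℕ) : T2Space (TopCat.disk.{u} n) :=
  inferInstanceAs (T2Space (ULift (Metric.closedBall (0 : EuclideanSpace ℝ (Fin n)) 1)))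

instance (n : ℕ) : T2Space (TopCat.diskBoundary.{u} n) :=
  inferInstanceAs (T2Space (ULift (Metric.sphere (0 : EuclideanSpace ℝ (Fin n)) 1)))

/-- The globe of the disk `D^n`. -/
abbrev diskGlobe (T : SpaceConvention) (P : ReparamKind) (n : ℕ) : MDSpace.{u} T P :=
  globe T P (TopCat.disk.{u} n)

/-- The globe of the sphere `S^{n-1}`, the boundary of `D^n` (empty if `n = 0`). -/
abbrev sphereGlobe (T : SpaceConvention) (P : ReparamKind) (n : ℕ) : MDSpace.{u} T P :=
  globe T P (TopCat.diskBoundary.{u} n)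

/-- The map of globes induced by the inclusion of `S^{n-1}` in `D^n`. -/
abbrev globeInclusion (T : SpaceConvention) (P : ReparamKind) (n : ℕ) :
    sphereGlobe.{u} T P n ⟶ diskGlobe.{u} T P n :=
  globeMap T P (TopCat.diskBoundaryInclusion.{u} n).hom

/-- A cellular `𝒫`-multipointed `d`-space with its cell decomposition. An ordinal `λ` is given by
a well-ordered set `J` of order type `λ + 1`, so that the greatest element `⊤` of `J` plays the
role of `λ`, and the elements `ν < ⊤` of `J` are the ordinals `ν < λ`. -/
structure CellularMDSpace (T : SpaceConvention) (P : ReparamKind) (J : Type u) [LinearOrder J]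
    [SuccOrder J] [OrderBot J] [OrderTop J] where
  /-- the tower `ν ↦ X_ν`, for `ν ≤ λ` -/
  tower : J ⥤ MDSpace.{u} T P
  /-- at a limit ordinal `ν ≤ λ`, the space `X_ν` is the colimit of the previous ones -/
  continuous_tower : tower.IsWellOrderContinuous
  /-- `X_0` is a set -/
  isSet_bot : (tower.obj ⊥).IsSet
  /-- the dimension `n_ν` of the disk of the `ν`-th cell -/
  dim : Iio (⊤ : J) → ℕ
  /-- the attaching map `g_ν` -/
  attach (ν : Iio (⊤ : J)) : sphereGlobe.{u} T P (dim ν) ⟶ tower.obj ν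
  /-- the map `ĝ_ν` to `X_{ν+1}` -/
  char (ν : Iio (⊤ : J)) : diskGlobe.{u} T P (dim ν) ⟶ tower.obj (Order.succ (ν : J))
  isPushout (ν : Iio (⊤ : J)) :
    IsPushout (attach ν) (globeInclusion T P (dim ν))
      (tower.map (homOfLE (Order.le_succ (ν : J)))) (char ν)

/-- `γ` is the Moore composition `(p_1 μ_{ℓ_1}) * ⋯ * (p_n μ_{ℓ_n})`, where `ℓ_1 + ⋯ + ℓ_n = 1`,
all `ℓ_i > 0`, and `μ_ℓ : [0,ℓ] → [0,1]` is `t ↦ t / ℓ`: for each `i`, the path `γ` runs through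
`p_i` at constant speed on the segment from `ℓ_1 + ⋯ + ℓ_{i-1}` to `ℓ_1 + ⋯ + ℓ_i`. -/
def IsMooreComposition {Y : Type*} [TopologicalSpace Y] (γ : C(I, Y)) {n : ℕ}
    (p : Fin n → C(I, Y)) (ℓ : Fin n → ℝ) : Prop :=
  (∀ i, 0 < ℓ i) ∧ ∑ i, ℓ i = 1 ∧
    ∀ (i : Fin n) (s t : I), (s : ℝ) = (∑ j ∈ Finset.Iio i, ℓ j) + ℓ i * t → γ s = p i t

namespace CellularMDSpace

variable {T : SpaceConvention} {P : ReparamKind} {J : Type u} [LinearOrder J] [SuccOrder J]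
  [OrderBot J] [OrderTop J] (X : CellularMDSpace.{u} T P J)

/-- The cellular multipointed `d`-space `X_λ` itself. -/
abbrev total : MDSpace.{u} T P := X.tower.obj ⊤

/-- The map `ĝ_ν` to `X_λ`. -/
def cellMap (ν : Iio (⊤ : J)) : diskGlobe.{u} T P (X.dim ν) ⟶ X.total :=
  X.char ν ≫ X.tower.map (homOfLE le_top)

/-- The execution path `ĝ_ν δ_z φ` of `X_λ`. -/
def cellPath (ν : Iio (⊤ : J)) (z : TopCat.disk.{u} (X.dim ν)) (φ : C(I, I)) : C(I, X.total) :=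
  (X.cellMap ν).map.comp ((GlobeSpace.delta z).comp φ)

/-- `[c_{ν_1}, …, c_{ν_n}]` is the sequence of cells of a decomposition of `γ` as a Moore
composition `(ĝ_{ν_1} δ_{z_1} φ_1 μ_{ℓ_1}) * ⋯ * (ĝ_{ν_n} δ_{z_n} φ_n μ_{ℓ_n})` with all `z_i` in
the interior of the disk and all `φ_i` in `𝒫(1,1)`. A globular cell `c_ν` is denoted by its
index `ν` (distinct cells are disjoint and nonempty). -/
def IsCarrier (γ : C(I, X.total)) (c : List (Iio (⊤ : J))) : Prop :=
  ∃ (z : ∀ i : Fin c.length, TopCat.disk.{u} (X.dim (c.get i))) (φ : Fin c.length → C(I, I))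
    (ℓ : Fin c.length → ℝ),
    (∀ i, z i ∉ range (TopCat.diskBoundaryInclusion.{u} (X.dim (c.get i)))) ∧
    (∀ i, P.Mem (φ i)) ∧
    IsMooreComposition γ (fun i => X.cellPath (c.get i) (z i) (φ i)) ℓ

open Classical in
/-- The carrier of an execution path `γ` (the value `[]` is for continuous maps without carrier;
execution paths have exactly one carrier). -/
def carrier (γ : C(I, X.total)) : List (Iio (⊤ : J)) :=
  if h : ∃ c, X.IsCarrier γ c then h.choose else []

/-- The natural length of an execution path: the length of its carrier. -/
def naturalLength (γ : C(I, X.total)) : ℕ := (X.carrier γ).length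

end CellularMDSpace

end

/-! ### Δ-generated spaces -/

/-! Continuous real functions on a cellular space are abundant. The globes of disks and spheres are
compact Hausdorff, so Tietze's theorem extends functions cell by cell along the tower, with
arbitrary values on the states and at finitely many points of each open cell
(`exists_continuousMap`). Hence `X_λ` is Hausdorff, its open cells are disjoint from one another and
from the image of `X_0`, and a compact subset meets finitely many open cells
(`finite_cells_of_isCompact`).

The paths with a carrier are stable under reparametrization and normalized composition and include
those coming from the cells, so by the universal properties of the tower they exhaust the execution
paths (`lands_id`, `carriedSub_lands_id`). For uniqueness, a path is at a state at each cut of a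
subdivision and visits a single open cell between two consecutive cuts. Comparing two subdivisions
shows that each carrier is a sublist of the other (`IsSubdivision.sublist`).

By compactness of the square, the paths `ψ(u)` together meet finitely many open cells. If the
passages through one cell `c_ν` could be arbitrarily short, a limit `z` of the points of the disk
involved would make `ĝ_ν δ_z` constant. But `ĝ_ν δ_z` is an execution path, even for `z` on the
boundary sphere, and no execution path is constant (`exists_ne_of_mem_paths`). So each cell has a
minimal passage time (`exists_lt_of_isPiece`). As the total time is 1, natural lengths are bounded,
and only finitely many words of bounded length exist on a finite set of cells. -/

theorem Homeomorph.deltaGeneratedSpace {X Y : Type*} [TopologicalSpace X] [TopologicalSpace Y]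
    [DeltaGeneratedSpace X] (e : X ≃ₜ Y) : DeltaGeneratedSpace Y :=
  e.isQuotientMap.isGeneratedBy

theorem deltaGeneratedSpace_of_leftInverse {X Y : Type*} [TopologicalSpace X] [TopologicalSpace Y]
    [DeltaGeneratedSpace X] {r : X → Y} {i : Y → X} (hr : Continuous r) (hi : Continuous i)
    (h : Function.LeftInverse r i) : DeltaGeneratedSpace Y :=
  (IsQuotientMap.of_inverse hi hr h).isGeneratedBy

theorem NormedSpace.deltaGeneratedSpace (V : Type*) [NormedAddCommGroup V] [NormedSpace ℝ V]
    [FiniteDimensional ℝ V] : DeltaGeneratedSpace V :=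
  (ContinuousLinearEquiv.ofFinrankEq (𝕜 := ℝ) (E := Fin (Module.finrank ℝ V) → ℝ) (F := V)
    (by simp)).toHomeomorph.deltaGeneratedSpace

/-- Open subsets of finite dimensional normed spaces are Δ-generated. -/
theorem IsOpen.deltaGeneratedSpace {V : Type*} [NormedAddCommGroup V] [NormedSpace ℝ V]
    [FiniteDimensional ℝ V] {U : Set V} (hU : IsOpen U) : DeltaGeneratedSpace U := by
  have := NormedSpace.deltaGeneratedSpace V
  refine ⟨continuous_iff_continuousAt.2 fun x => ?_⟩
  obtain ⟨r, hr, hrU⟩ := Metric.isOpen_iff.1 hU x x.2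
  -- A ball around `x` inside `U` is a copy of `V`, which is Δ-generated. Near `x`, the map to be
  -- proved continuous is `(equiv.symm ∘ f) ∘ b.symm`.
  let b := OpenPartialHomeomorph.univBall (x : V) r
  have hb : ∀ v, b v ∈ Metric.ball (x : V) r := fun v => by
    rw [← OpenPartialHomeomorph.univBall_target (x : V) hr]
    exact b.map_source (by simp [b])
  let f : V → U := fun v => ⟨b v, hrU (hb v)⟩
  have hf : Continuous f :=
    (OpenPartialHomeomorph.continuous_univBall (x : V) r).subtype_mk _
  have hg : Continuous (WithGeneratedByTopology.equiv.symm ∘ f :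
      V → DeltaGeneratedSpace.of (Y := U)) :=
    (IsGeneratedBy.equiv_symm_comp_continuous_iff (X := fun n : ℕ => Fin n → ℝ) f).2 hf
  have hs : ContinuousAt (fun y : U => b.symm y) x :=
    ((OpenPartialHomeomorph.continuousOn_univBall_symm (x : V) r).continuousAt
      (Metric.ball_mem_nhds _ hr)).comp continuous_subtype_val.continuousAt
  refine (hg.continuousAt.comp hs).congr ?_
  have : ∀ᶠ y : U in 𝓝 x, (y : V) ∈ Metric.ball (x : V) r :=
    continuous_subtype_val.continuousAt.eventually_mem (Metric.ball_mem_nhds _ hr)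
  filter_upwards [this] with y hy
  have : f (b.symm y) = y := Subtype.ext (b.right_inv (by
    rwa [OpenPartialHomeomorph.univBall_target (x : V) hr]))
  simp [this]

instance TopCat.deltaGeneratedSpace_disk_prod (n : ℕ) :
    DeltaGeneratedSpace (TopCat.disk.{u} n × I) := by
  have := NormedSpace.deltaGeneratedSpace (EuclideanSpace ℝ (Fin n) × ℝ)
  have hpos (x : EuclideanSpace ℝ (Fin n)) : 0 < max 1 ‖x‖ := lt_max_of_lt_left one_pos
  have hmem (x : EuclideanSpace ℝ (Fin n)) :
      (max 1 ‖x‖)⁻¹ • x ∈ Metric.closedBall (0 : EuclideanSpace ℝ (Fin n)) 1 := by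
    rw [mem_closedBall_zero_iff, norm_smul, norm_inv, Real.norm_of_nonneg (hpos x).le,
      inv_mul_le_one₀ (hpos x)]
    exact le_max_right _ _
  -- Radial projection makes the disk times `I` a retract of a finite dimensional normed space.
  refine deltaGeneratedSpace_of_leftInverse (X := EuclideanSpace ℝ (Fin n) × ℝ)
    (r := fun p => ((ULift.up ⟨(max 1 ‖p.1‖)⁻¹ • p.1, hmem p.1⟩ : ULift _),
      Set.projIcc 0 1 zero_le_one p.2))
    (i := fun p => (((p.1 : ULift _).down : EuclideanSpace ℝ (Fin n)), (p.2 : ℝ))) ?_ ?_ ?_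
  · refine Continuous.prodMk (continuous_uliftUp.comp (Continuous.subtype_mk ?_ _))
      (continuous_projIcc.comp continuous_snd)
    exact ((continuous_const.max continuous_fst.norm).inv₀ fun p => (hpos p.1).ne').smul
      continuous_fst
  · exact (continuous_subtype_val.comp (continuous_uliftDown.comp continuous_fst)).prodMk
      (continuous_subtype_val.comp continuous_snd)
  · rintro ⟨⟨x, hx⟩, t⟩
    have hx' : ‖x‖ ≤ 1 := mem_closedBall_zero_iff.1 hx
    refine Prod.ext (congrArg ULift.up (Subtype.ext ?_)) (by simp)
    simp [max_eq_left hx']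

instance TopCat.deltaGeneratedSpace_diskBoundary_prod (n : ℕ) :
    DeltaGeneratedSpace (TopCat.diskBoundary.{u} n × I) := by
  -- Normalization retracts the complement of the origin onto the sphere; for `n = 0` both are
  -- empty.
  let U : Set (EuclideanSpace ℝ (Fin n) × ℝ) := {p | p.1 ≠ 0}
  have : DeltaGeneratedSpace U :=
    IsOpen.deltaGeneratedSpace (isOpen_ne.preimage continuous_fst)
  have hpos (p : U) : ‖p.1.1‖ ≠ 0 := norm_ne_zero_iff.2 p.2
  refine deltaGeneratedSpace_of_leftInverse (X := U)
    (r := fun p => ((ULift.up ⟨‖p.1.1‖⁻¹ • p.1.1, by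
        rw [mem_sphere_zero_iff_norm, norm_smul, norm_inv, norm_norm, inv_mul_cancel₀ (hpos p)]⟩ :
          ULift _),
      Set.projIcc 0 1 zero_le_one p.1.2))
    (i := fun p => ⟨(((p.1 : ULift _).down : EuclideanSpace ℝ (Fin n)), (p.2 : ℝ)),
      fun h => by
        have h1 := mem_sphere_zero_iff_norm.1 (p.1 : ULift _).down.2
        exact one_ne_zero (h1.symm.trans (norm_eq_zero.2 h))⟩) ?_ ?_ ?_
  · have h1 : Continuous fun p : U => p.1.1 := continuous_fst.comp continuous_subtype_val
    refine Continuous.prodMk (continuous_uliftUp.comp (Continuous.subtype_mk ?_ _))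
      (continuous_projIcc.comp (continuous_snd.comp continuous_subtype_val))
    exact (h1.norm.inv₀ hpos).smul h1
  · exact ((continuous_subtype_val.comp (continuous_uliftDown.comp continuous_fst)).prodMk
      (continuous_subtype_val.comp continuous_snd)).subtype_mk _
  · rintro ⟨⟨x, hx⟩, t⟩
    have hx' : ‖x‖ = 1 := mem_sphere_zero_iff_norm.1 hx
    refine Prod.ext (congrArg ULift.up (Subtype.ext ?_)) (by simp)
    simp [hx']

/-! ### The inclusion of the globe of a sphere in the globe of a disk -/

namespace GlobeSpace

variable {Z Z' : Type u} [TopologicalSpace Z] [TopologicalSpace Z']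

/-- When the ordinary product is already Δ-generated, the product used in the globe is homeomorphic
to it, hence compact. This is what makes Tietze's theorem available on globes. -/
theorem compactSpace [CompactSpace Z] [DeltaGeneratedSpace (Z × I)] :
    CompactSpace (GlobeSpace Z) := by
  have : CompactSpace (DeltaGeneratedSpace.of (Y := Z × I)) :=
    (IsGeneratedBy.homeomorph (X := fun n : ℕ => Fin n → ℝ) (Y := Z × I)).symm.compactSpace
  exact inferInstanceAs (CompactSpace (Quot (GlobeRel Z)))

instance (n : ℕ) : CompactSpace (GlobeSpace (TopCat.disk.{u} n)) := compactSpace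

instance (n : ℕ) : CompactSpace (GlobeSpace (TopCat.diskBoundary.{u} n)) := compactSpace

@[simp] theorem map_point (f : C(Z, Z')) (z : Z) (t : I) : map f (point z t) = point (f z) t := rfl

@[simp] theorem map_state (f : C(Z, Z')) (b : Bool) : map f (state b) = state b := rfl

theorem point_injOn {z z' : Z} {t t' : I} (h0 : t ≠ 0) (h1 : t ≠ 1)
    (h : point z t = point z' t') : z = z' ∧ t = t' := by
  have ht : t = t' := congrArg height h
  subst ht
  have hz := congrArg (· ∈ overOpen ({z} : Set Z)) h
  exact ⟨((iff_of_eq hz).1 ⟨rfl, h0, h1⟩).1.symm, rfl⟩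

theorem height_map (f : C(Z, Z')) (x : GlobeSpace Z) : height (map f x) = height x := by
  rcases cases x with rfl | rfl | ⟨z, t, -, -, rfl⟩ <;> rfl

theorem map_injective {f : C(Z, Z')} (hf : Function.Injective f) :
    Function.Injective (map f) := by
  intro x y hxy
  have hh : height x = height y := by rw [← height_map f x, ← height_map f y, hxy]
  rcases cases x with rfl | rfl | ⟨z, t, h0, h1, rfl⟩ <;>
    rcases cases y with rfl | rfl | ⟨z', t', h0', h1', rfl⟩ <;>
    simp_all [eq_comm]
  rw [hf (point_injOn h0' h1' hxy).1]

theorem point_mem_range_map {f : C(Z, Z')} {z : Z'} {t : I} (h0 : t ≠ 0) (h1 : t ≠ 1) :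
    point z t ∈ range (map f) ↔ z ∈ range f := by
  constructor
  · rintro ⟨x, hx⟩
    have hh : height x = t := by rw [← height_map f x, hx, height_point]
    rcases cases x with rfl | rfl | ⟨z', t', h0', h1', rfl⟩
    · exact absurd hh.symm h0
    · exact absurd hh.symm h1
    · exact ⟨z', (point_injOn h0' h1' hx).1⟩
  · rintro ⟨z', rfl⟩
    exact ⟨point z' t, rfl⟩

/-- Tietze extension with prescribed values at finitely many points. -/
theorem exists_extension [T2Space Z] [T2Space Z'] [CompactSpace (GlobeSpace Z)]
    [CompactSpace (GlobeSpace Z')] {f : C(Z, Z')} (hf : Function.Injective f)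
    (h : C(GlobeSpace Z, ℝ)) {s : Set (GlobeSpace Z')} (hs : s.Finite)
    (hd : Disjoint (range (map f)) s) (k : GlobeSpace Z' → ℝ) :
    ∃ g : C(GlobeSpace Z', ℝ), g.comp (map f) = h ∧ ∀ x ∈ s, g x = k x := by
  have := hs.to_subtype
  have : DiscreteTopology s := inferInstance
  -- The small globe and the finite set are disjoint, so together they inject from a compact space
  -- into a Hausdorff one.
  have he : IsClosedEmbedding (Sum.elim (map f) ((↑) : s → GlobeSpace Z')) := by
    refine Continuous.isClosedEmbedding ((map f).continuous.sumElim continuous_subtype_val)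
      (Function.Injective.sumElim (map_injective hf) Subtype.val_injective ?_)
    exact fun a b e => Set.disjoint_left.1 hd ⟨a, rfl⟩ (e ▸ b.2)
  obtain ⟨g, hg⟩ := ContinuousMap.exists_extension' he
    ⟨Sum.elim h fun x : s => k x, h.continuous.sumElim continuous_of_discreteTopology⟩
  exact ⟨g, ContinuousMap.ext fun x => congrFun hg (.inl x), fun x hx =>
    congrFun hg (.inr ⟨x, hx⟩)⟩

end GlobeSpace

theorem TopCat.diskBoundaryInclusion_injective (n : ℕ) :
    Function.Injective (TopCat.diskBoundaryInclusion.{u} n).hom :=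
  (TopCat.mono_iff_injective _).1 inferInstance

/-! ### Normalized composition of paths -/

theorem normComp_apply {Y : Type*} [TopologicalSpace Y] (γ₁ γ₂ : C(I, Y)) (h : γ₁ 1 = γ₂ 0)
    (s : I) : normComp γ₁ γ₂ h s = if (s : ℝ) ≤ 1 / 2
      then γ₁ (Set.projIcc 0 1 zero_le_one (2 * (s : ℝ)))
      else γ₂ (Set.projIcc 0 1 zero_le_one (2 * (s : ℝ) - 1)) := rfl

theorem comp_normComp {Y Z : Type*} [TopologicalSpace Y] [TopologicalSpace Z] (f : C(Y, Z))
    (γ₁ γ₂ : C(I, Y)) (h : γ₁ 1 = γ₂ 0) :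
    f.comp (normComp γ₁ γ₂ h) = normComp (f.comp γ₁) (f.comp γ₂) (congrArg f h) := by
  ext s
  simp only [ContinuousMap.comp_apply, normComp_apply]
  split_ifs <;> rfl

theorem normComp_zero {Y : Type*} [TopologicalSpace Y] (γ₁ γ₂ : C(I, Y)) (h : γ₁ 1 = γ₂ 0) :
    normComp γ₁ γ₂ h 0 = γ₁ 0 := by
  simp [normComp_apply]

theorem normComp_one {Y : Type*} [TopologicalSpace Y] (γ₁ γ₂ : C(I, Y)) (h : γ₁ 1 = γ₂ 0) :
    normComp γ₁ γ₂ h 1 = γ₂ 1 := by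
  rw [normComp_apply, if_neg (by norm_num)]
  congr 1
  ext
  norm_num

/-! ### Subobjects and factorization of the identity -/

namespace MDSpace

variable {T : SpaceConvention} {P : ReparamKind}

theorem hom_ext' {X Y : MDSpace.{u} T P} {f g : X ⟶ Y} (h : f.map = g.map) : f = g :=
  Hom.ext h

/-- A set of points, a set of states and a set of paths which is closed under the operations of a
multipointed `d`-space. -/
structure Sub (X : MDSpace.{u} T P) where
  points : Set X
  states : Set X
  paths : Set C(I, X)
  source_mem : ∀ γ ∈ paths, γ 0 ∈ states
  target_mem : ∀ γ ∈ paths, γ 1 ∈ states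
  reparam_mem : ∀ γ ∈ paths, ∀ φ : C(I, I), P.Mem φ → γ.comp φ ∈ paths
  normComp_mem : ∀ γ₁ ∈ paths, ∀ γ₂ ∈ paths, ∀ h : γ₁ 1 = γ₂ 0, normComp γ₁ γ₂ h ∈ paths

namespace Sub

/-- A map lands in `S` if it sends points, states and paths to those of `S`. -/
structure Lands {X Y : MDSpace.{u} T P} (f : X ⟶ Y) (S : Sub Y) : Prop where
  points (x : X) : f.map x ∈ S.points
  states : ∀ x ∈ X.states, f.map x ∈ S.states
  paths : ∀ γ ∈ X.paths, f.map.comp γ ∈ S.paths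

/-- The inverse image of `S`. -/
def comap {X Y : MDSpace.{u} T P} (f : X ⟶ Y) (S : Sub Y) : Sub X where
  points := f.map ⁻¹' S.points
  states := f.map ⁻¹' S.states
  paths := {γ | f.map.comp γ ∈ S.paths}
  source_mem γ hγ := S.source_mem _ hγ
  target_mem γ hγ := S.target_mem _ hγ
  reparam_mem γ hγ φ hφ := S.reparam_mem _ hγ φ hφ
  normComp_mem γ₁ h₁ γ₂ h₂ h := by
    rw [mem_ofPred_eq, comp_normComp]
    exact S.normComp_mem _ h₁ _ h₂ _

theorem lands_comp_iff {X Y Z : MDSpace.{u} T P} (f : X ⟶ Y) (g : Y ⟶ Z) (S : Sub Z) :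
    S.Lands (f ≫ g) ↔ (S.comap g).Lands f :=
  ⟨fun h => ⟨h.1, h.2, h.3⟩, fun h => ⟨h.1, h.2, h.3⟩⟩

variable {X : MDSpace.{u} T P} (S : Sub X)

/-- The inclusion of the points of `S`, with the Δ-generated topology. -/
def pointsIncl : C(DeltaGeneratedSpace.of (Y := S.points), X) :=
  ⟨fun w => (WithGeneratedByTopology.equiv w : S.points),
    continuous_subtype_val.comp WithGeneratedByTopology.continuous_equiv⟩

theorem pointsIncl_injective : Function.Injective S.pointsIncl :=
  Subtype.val_injective.comp WithGeneratedByTopology.equiv.injective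

/-- The multipointed `d`-space determined by `S`: its states and paths are those of `S` which are
states and paths of `X`. -/
def space : MDSpace.{u} T P where
  carrier := DeltaGeneratedSpace.of (Y := S.points)
  hausdorff hT φ := by
    have := (X.hausdorff hT (S.pointsIncl.comp φ)).preimage S.pointsIncl.continuous
    rwa [ContinuousMap.coe_comp, range_comp, S.pointsIncl_injective.preimage_image] at this
  states := {w | S.pointsIncl w ∈ S.states ∧ S.pointsIncl w ∈ X.states}
  paths := {γ | S.pointsIncl.comp γ ∈ S.paths ∧ S.pointsIncl.comp γ ∈ X.paths}
  source_mem _ hγ := ⟨S.source_mem _ hγ.1, X.source_mem _ hγ.2⟩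
  target_mem _ hγ := ⟨S.target_mem _ hγ.1, X.target_mem _ hγ.2⟩
  reparam_mem _ hγ φ hφ := ⟨S.reparam_mem _ hγ.1 φ hφ, X.reparam_mem _ hγ.2 φ hφ⟩
  normComp_mem _ h₁ _ h₂ h := by
    rw [mem_ofPred_eq, comp_normComp]
    exact ⟨S.normComp_mem _ h₁.1 _ h₂.1 _, X.normComp_mem _ h₁.2 _ h₂.2 _⟩

/-- The inclusion of `S`. -/
def incl : S.space ⟶ X where
  map := S.pointsIncl
  map_states _ hx := hx.2
  map_paths _ hγ := hγ.2

instance : Mono S.incl where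
  right_cancellation _ _ e := hom_ext' (ContinuousMap.ext fun x =>
    S.pointsIncl_injective (congrArg (fun k : _ ⟶ X => k.map x) e))

variable {S}

/-- The factorization of a map which lands in `S`. -/
def lift {Y : MDSpace.{u} T P} {f : Y ⟶ X} (hf : S.Lands f) : Y ⟶ S.space where
  map := ⟨(WithGeneratedByTopology.equiv (X := fun n : ℕ => Fin n → ℝ)).symm ∘
      fun y => (⟨f.map y, hf.points y⟩ : S.points),
    (IsGeneratedBy.equiv_symm_comp_continuous_iff (X := fun n : ℕ => Fin n → ℝ) _).2
      (f.map.continuous.subtype_mk _)⟩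
  map_states x hx := ⟨hf.states x hx, f.map_states x hx⟩
  map_paths γ hγ := ⟨hf.paths γ hγ, f.map_paths γ hγ⟩

@[simp] theorem lift_incl {Y : MDSpace.{u} T P} {f : Y ⟶ X} (hf : S.Lands f) :
    lift hf ≫ S.incl = f := rfl

theorem lands_id_of_section (r : X ⟶ S.space) (hr : r ≫ S.incl = 𝟙 X) : S.Lands (𝟙 X) := by
  rw [← hr]
  exact ⟨fun x => (WithGeneratedByTopology.equiv (X := fun n : ℕ => Fin n → ℝ) (r.map x)).2,
    fun x hx => (r.map_states x hx).1, fun γ hγ => (r.map_paths γ hγ).1⟩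

/-- Both legs factor through the monomorphism `S.incl`; the map they induce on the pushout is a
section of it, so `S` contains everything. -/
theorem lands_id_of_isPushout {A B C : MDSpace.{u} T P} {f : A ⟶ B} {g : A ⟶ C} {inl : B ⟶ X}
    {inr : C ⟶ X} (h : IsPushout f g inl inr) (hl : S.Lands inl) (hr : S.Lands inr) :
    S.Lands (𝟙 X) := by
  have hw : f ≫ lift hl = g ≫ lift hr := by
    rw [← cancel_mono S.incl, Category.assoc, Category.assoc]
    exact h.w
  refine lands_id_of_section (h.desc _ _ hw) (h.hom_ext ?_ ?_)
  · rw [h.inl_desc_assoc, lift_incl, Category.comp_id]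
  · rw [h.inr_desc_assoc, lift_incl, Category.comp_id]

open Limits in
theorem lands_id_of_isColimit {K : Type*} [Category K] {F : K ⥤ MDSpace.{u} T P} {c : Cocone F}
    (hc : IsColimit c) {S : Sub c.pt} (h : ∀ k, S.Lands (c.ι.app k)) : S.Lands (𝟙 c.pt) := by
  let d : Cocone F :=
    { pt := S.space
      ι :=
        { app := fun k => lift (h k)
          naturality := fun k k' f => by
            rw [← cancel_mono S.incl, Category.assoc, Category.assoc, lift_incl]
            exact c.ι.naturality f } }
  refine lands_id_of_section (hc.desc d) (hc.hom_ext fun k => ?_)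
  rw [hc.fac_assoc, Category.comp_id]
  exact lift_incl (h k)

end Sub

end MDSpace

/-! ### Induction along the tower -/

namespace CellularMDSpace

variable {T : SpaceConvention} {P : ReparamKind} {J : Type u} [LinearOrder J] [SuccOrder J]
  [OrderBot J] [OrderTop J] (X : CellularMDSpace.{u} T P J)

/-- The map from the `ν`-th stage of the tower. -/
abbrev stage (κ : J) : X.tower.obj κ ⟶ X.total := X.tower.map (homOfLE le_top)

theorem map_stage {κ κ' : J} (h : κ ≤ κ') :
    X.tower.map (homOfLE h) ≫ X.stage κ' = X.stage κ := by
  rw [← X.tower.map_comp]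
  rfl

theorem inclusion_cellMap (ν : Iio (⊤ : J)) :
    globeInclusion T P (X.dim ν) ≫ X.cellMap ν = X.attach ν ≫ X.stage ν := by
  rw [cellMap, ← Category.assoc, ← (X.isPushout ν).w, Category.assoc]
  exact congrArg _ (X.map_stage _)

/-- Induction on the cells. -/
theorem lands_id [WellFoundedLT J] {S : MDSpace.Sub X.total} (h0 : S.Lands (X.stage ⊥))
    (h : ∀ ν : Iio (⊤ : J), S.Lands (X.stage ν) → S.Lands (X.cellMap ν)) : S.Lands (𝟙 X.total) := by
  have key (κ : J) : S.Lands (X.stage κ) := by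
    induction κ using WellFoundedLT.induction with
    | ind κ ih =>
    -- The goal becomes a statement on the identity of the `κ`-th stage and the inverse image of
    -- `S`, the form to which the universal properties apply.
    rw [← Category.id_comp (X.stage κ), MDSpace.Sub.lands_comp_iff]
    induction κ using Order.isSuccLimitRecOn with
    | isMin κ hκ =>
      obtain rfl := hκ.eq_bot
      rw [← MDSpace.Sub.lands_comp_iff, Category.id_comp]
      exact h0
    | succ ν hν =>
      have hν' : ν < ⊤ := lt_top_iff_ne_top.2 fun e => hν (e ▸ isMax_top)
      have ih' := ih ν (Order.lt_succ_of_not_isMax hν)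
      refine MDSpace.Sub.lands_id_of_isPushout (X.isPushout ⟨ν, hν'⟩) ?_ ?_
      · rw [← MDSpace.Sub.lands_comp_iff]
        exact (X.map_stage _).symm ▸ ih'
      · rw [← MDSpace.Sub.lands_comp_iff]
        exact h ⟨ν, hν'⟩ ih'
    | isSuccLimit κ hκ =>
      have := X.continuous_tower
      refine MDSpace.Sub.lands_id_of_isColimit
        (X.tower.isColimitOfIsWellOrderContinuous κ hκ) (S := S.comap (X.stage κ)) fun k => ?_
      have h' := ih k.1 k.2
      rw [← X.map_stage (le_of_lt k.2), MDSpace.Sub.lands_comp_iff] at h'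
      exact h'
  have := key ⊤
  rwa [show X.stage ⊤ = 𝟙 _ from X.tower.map_id _] at this

end CellularMDSpace

/-! ### Cellular recursion for maps out of the tower -/

namespace CellularMDSpace

variable {T : SpaceConvention} {P : ReparamKind} {J : Type u} [LinearOrder J] [SuccOrder J]
  [OrderBot J] [OrderTop J] (X : CellularMDSpace.{u} T P J)

theorem map_comp_map {κ₁ κ₂ κ₃ : J} (h : κ₁ ≤ κ₂) (h' : κ₂ ≤ κ₃) {R : MDSpace.{u} T P}
    (F : X.tower.obj κ₃ ⟶ R) : X.tower.map (homOfLE h) ≫ X.tower.map (homOfLE h') ≫ F =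
      X.tower.map (homOfLE (h.trans h')) ≫ F := by
  rw [← Functor.map_comp_assoc]
  rfl

theorem map_refl_comp {κ : J} (h : κ ≤ κ) {R : MDSpace.{u} T P} (F : X.tower.obj κ ⟶ R) :
    X.tower.map (homOfLE h) ≫ F = F := by
  rw [show homOfLE h = 𝟙 κ from rfl, X.tower.map_id, Category.id_comp]

theorem hom_ext_succ (ν : Iio (⊤ : J)) {R : MDSpace.{u} T P}
    {F G : X.tower.obj (Order.succ (ν : J)) ⟶ R}
    (h : X.tower.map (homOfLE (Order.le_succ (ν : J))) ≫ F =
      X.tower.map (homOfLE (Order.le_succ (ν : J))) ≫ G)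
    (h' : X.char ν ≫ F = X.char ν ≫ G) : F = G :=
  (X.isPushout ν).hom_ext h h'

theorem hom_ext_limit {κ : J} (hκ : Order.IsSuccLimit κ) {R : MDSpace.{u} T P}
    {F G : X.tower.obj κ ⟶ R}
    (h : ∀ κ' (hl : κ' < κ), X.tower.map (homOfLE hl.le) ≫ F = X.tower.map (homOfLE hl.le) ≫ G) :
    F = G := by
  have := X.continuous_tower
  exact (X.tower.isColimitOfIsWellOrderContinuous κ hκ).hom_ext fun k => h k.1 k.2

theorem exists_hom_limit {κ : J} (hκ : Order.IsSuccLimit κ) {R : MDSpace.{u} T P}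
    (G : ∀ κ', κ' < κ → (X.tower.obj κ' ⟶ R))
    (hG : ∀ κ₁ κ₂ (h : κ₁ ≤ κ₂) (h₂ : κ₂ < κ),
      X.tower.map (homOfLE h) ≫ G κ₂ h₂ = G κ₁ (h.trans_lt h₂)) :
    ∃ F : X.tower.obj κ ⟶ R, ∀ κ' (h : κ' < κ), X.tower.map (homOfLE h.le) ≫ F = G κ' h := by
  have := X.continuous_tower
  let c : Limits.Cocone ((Set.principalSegIio κ).monotone.functor ⋙ X.tower) :=
    { pt := R
      ι :=
        { app := fun k => G k.1 k.2
          naturality := fun k k' f => (hG k.1 k'.1 (leOfHom f) k'.2).trans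
            (Category.comp_id _).symm } }
  exact ⟨(X.tower.isColimitOfIsWellOrderContinuous κ hκ).desc c, fun κ' h =>
    (X.tower.isColimitOfIsWellOrderContinuous κ hκ).fac c ⟨κ', h⟩⟩

section Recursion

variable {R : MDSpace.{u} T P} (f₀ : X.tower.obj ⊥ ⟶ R)
  (E : ∀ ν : Iio (⊤ : J), (sphereGlobe.{u} T P (X.dim ν) ⟶ R) → (diskGlobe.{u} T P (X.dim ν) ⟶ R))

/-- `F` is defined on the `κ`-th stage by cellular recursion from `f₀` and the extensions `E`. -/
structure IsRecursive (κ : J) (F : X.tower.obj κ ⟶ R) : Prop where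
  base : X.tower.map (homOfLE bot_le) ≫ F = f₀
  cell (ν : Iio (⊤ : J)) (h : Order.succ (ν : J) ≤ κ) :
    X.char ν ≫ X.tower.map (homOfLE h) ≫ F =
      E ν (X.attach ν ≫ X.tower.map (homOfLE ((Order.le_succ (ν : J)).trans h)) ≫ F)

variable {X f₀ E}

theorem IsRecursive.restrict {κ κ' : J} {F : X.tower.obj κ ⟶ R} (hF : X.IsRecursive f₀ E κ F)
    (h : κ' ≤ κ) : X.IsRecursive f₀ E κ' (X.tower.map (homOfLE h) ≫ F) where
  base := by
    rw [map_comp_map]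
    exact hF.base
  cell ν hν := by
    rw [map_comp_map, map_comp_map]
    exact hF.cell ν (hν.trans h)

/-- The extensions `E` are fixed functions, so nothing is chosen at any stage. This rigidity makes
the maps on the earlier stages compatible at limit ordinals in `exists_isRecursive`. -/
theorem IsRecursive.unique [WellFoundedLT J] {κ : J} {F G : X.tower.obj κ ⟶ R}
    (hF : X.IsRecursive f₀ E κ F) (hG : X.IsRecursive f₀ E κ G) : F = G := by
  induction κ using WellFoundedLT.induction with
  | ind κ ih =>
  induction κ using Order.isSuccLimitRecOn with
  | isMin κ hκ =>
    obtain rfl := hκ.eq_bot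
    rw [← X.map_refl_comp bot_le F, ← X.map_refl_comp bot_le G, hF.base, hG.base]
  | succ ν hν =>
    have hν' : ν < ⊤ := lt_top_iff_ne_top.2 fun e => hν (e ▸ isMax_top)
    have h := ih ν (Order.lt_succ_of_not_isMax hν) (hF.restrict (Order.le_succ ν))
      (hG.restrict (Order.le_succ ν))
    refine X.hom_ext_succ ⟨ν, hν'⟩ h ?_
    have h1 := hF.cell ⟨ν, hν'⟩ le_rfl
    have h2 := hG.cell ⟨ν, hν'⟩ le_rfl
    rw [map_refl_comp] at h1 h2
    rw [h1, h2, h]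
  | isSuccLimit κ hκ =>
    exact X.hom_ext_limit hκ fun κ' hl => ih κ' hl (hF.restrict hl.le) (hG.restrict hl.le)

theorem exists_isRecursive [WellFoundedLT J]
    (hE : ∀ ν h, globeInclusion T P (X.dim ν) ≫ E ν h = h) (κ : J) :
    ∃ F, X.IsRecursive f₀ E κ F := by
  induction κ using WellFoundedLT.induction with
  | ind κ ih =>
  induction κ using Order.isSuccLimitRecOn with
  | isMin κ hκ =>
    obtain rfl := hκ.eq_bot
    refine ⟨f₀, X.map_refl_comp _ _, fun ν h => ?_⟩
    exact absurd (h.trans bot_le) (Order.lt_succ_of_not_isMax (not_isMax_of_lt ν.2)).not_ge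
  | succ ν hν =>
    have hν' : ν < ⊤ := lt_top_iff_ne_top.2 fun e => hν (e ▸ isMax_top)
    obtain ⟨F, hF⟩ := ih ν (Order.lt_succ_of_not_isMax hν)
    have hw := (hE ⟨ν, hν'⟩ (X.attach ⟨ν, hν'⟩ ≫ F)).symm
    let G := (X.isPushout ⟨ν, hν'⟩).desc _ _ hw
    have hG : X.tower.map (homOfLE (Order.le_succ ν)) ≫ G = F := (X.isPushout ⟨ν, hν'⟩).inl_desc ..
    have hG' : X.char ⟨ν, hν'⟩ ≫ G = E ⟨ν, hν'⟩ (X.attach ⟨ν, hν'⟩ ≫ F) :=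
      (X.isPushout ⟨ν, hν'⟩).inr_desc ..
    refine ⟨G, ?_, ?_⟩
    · rw [← X.map_comp_map bot_le (Order.le_succ ν), hG, hF.base]
    · rintro ⟨ν', hν''⟩ h
      -- Either the cell is the one just attached, or it belongs to an earlier stage, where `F`
      -- already satisfies the condition.
      obtain rfl | hlt := ((Order.succ_le_succ_iff_of_not_isMax (not_isMax_of_lt hν'')
        hν).1 h).eq_or_lt
      · rw [map_refl_comp, hG', hG]
      · rw [← X.map_comp_map (Order.succ_le_of_lt hlt) (Order.le_succ ν), hG,
          ← X.map_comp_map hlt.le (Order.le_succ ν), hG]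
        exact hF.cell ⟨ν', hν''⟩ (Order.succ_le_of_lt hlt)
  | isSuccLimit κ hκ =>
    choose G hG using ih
    obtain ⟨F, hF⟩ := X.exists_hom_limit hκ G fun κ₁ κ₂ h h₂ =>
      ((hG κ₂ h₂).restrict h).unique (hG κ₁ _)
    refine ⟨F, ?_, fun ν h => ?_⟩
    · rw [hF ⊥ hκ.bot_lt]
      exact (X.map_refl_comp _ _).symm.trans (hG ⊥ hκ.bot_lt).base
    · have hlt : Order.succ (ν : J) < κ := hκ.succ_lt
        ((Order.lt_succ_of_not_isMax (not_isMax_of_lt ν.2)).trans_le h)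
      have hlt' : (ν : J) < κ := (Order.le_succ (ν : J)).trans_lt hlt
      have := (hG _ hlt).cell ν le_rfl
      rw [← hF _ hlt, map_comp_map, map_comp_map] at this
      exact this

end Recursion

end CellularMDSpace

/-! ### Real valued functions -/

namespace MDSpace

variable (T : SpaceConvention) (P : ReparamKind)

instance : DeltaGeneratedSpace (ULift.{u} ℝ) :=
  have := NormedSpace.deltaGeneratedSpace ℝ
  Homeomorph.ulift.symm.deltaGeneratedSpace

/-- The real line, all points being states and all paths being execution paths. -/
def realLine : MDSpace.{u} T P where
  carrier := ULift.{u} ℝ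
  hausdorff _ φ := (isCompact_range φ.continuous).isClosed
  states := univ
  paths := univ
  source_mem _ _ := trivial
  target_mem _ _ := trivial
  reparam_mem _ _ _ _ := trivial
  normComp_mem _ _ _ _ _ := trivial

variable {T P}

/-- The map to the real line given by a continuous function. -/
def ofReal {X : MDSpace.{u} T P} (f : C(X, ℝ)) : X ⟶ realLine T P where
  map := ⟨fun x => ULift.up (f x), continuous_uliftUp.comp f.continuous⟩
  map_states _ _ := trivial
  map_paths _ _ := trivial

/-- The continuous function underlying a map to the real line. -/
def toReal {X : MDSpace.{u} T P} (f : X ⟶ realLine T P) : C(X, ℝ) :=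
  ⟨fun x => ULift.down (f.map x), continuous_uliftDown.comp f.map.continuous⟩

end MDSpace

namespace CellularMDSpace

open MDSpace

variable {T : SpaceConvention} {P : ReparamKind} {J : Type u} [LinearOrder J] [SuccOrder J]
  [OrderBot J] [OrderTop J] (X : CellularMDSpace.{u} T P J)

/-- The points of the globe of the disk of the `ν`-th cell which lie in the open cell. -/
def openCell (ν : Iio (⊤ : J)) : Set (GlobeSpace (TopCat.disk.{u} (X.dim ν))) :=
  (range (GlobeSpace.map (TopCat.diskBoundaryInclusion.{u} (X.dim ν)).hom))ᶜ

/-- A continuous function on a cellular space may have arbitrary values on the states and on a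
finite subset of each open cell. -/
theorem exists_continuousMap [WellFoundedLT J] (f₀ : X.tower.obj ⊥ → ℝ)
    (s : ∀ ν, Set (GlobeSpace (TopCat.disk.{u} (X.dim ν)))) (hs : ∀ ν, (s ν).Finite)
    (hs' : ∀ ν, s ν ⊆ X.openCell ν) (k : ∀ ν, GlobeSpace (TopCat.disk.{u} (X.dim ν)) → ℝ) :
    ∃ F : C(X.total, ℝ), (∀ x, F ((X.stage ⊥).map x) = f₀ x) ∧
      ∀ ν, ∀ x ∈ s ν, F ((X.cellMap ν).map x) = k ν x := by
  have := X.isSet_bot.1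
  have hext (ν) (h : sphereGlobe.{u} T P (X.dim ν) ⟶ realLine T P) :=
    GlobeSpace.exists_extension (TopCat.diskBoundaryInclusion_injective.{u} (X.dim ν))
      (toReal h) (hs ν) (Set.disjoint_left.2 fun x hx hx' => hs' ν hx' hx) (k ν)
  choose E hE hE' using hext
  -- Maps to `realLine` are just continuous functions, so the recursion in multipointed `d`-spaces
  -- produces arbitrary continuous functions on the underlying space.
  obtain ⟨F, hF⟩ := exists_isRecursive (X := X) (R := realLine T P)
    (f₀ := ofReal ⟨f₀, continuous_of_discreteTopology⟩) (E := fun ν h => ofReal (E ν h))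
    (fun ν h => hom_ext' (ContinuousMap.ext fun x =>
      congrArg ULift.up (congrArg (fun g : C(_, ℝ) => g x) (hE ν h)))) ⊤
  refine ⟨toReal F, fun x => ?_, fun ν x hx => ?_⟩
  · exact congrArg (fun g : _ ⟶ realLine T P => toReal g x) hF.base
  · exact (congrArg (fun g : diskGlobe.{u} T P (X.dim ν) ⟶ realLine T P => toReal g x)
      (hF.cell ν le_top)).trans (hE' ν _ x hx)

end CellularMDSpace

/-! ### Rescaling of reparametrizations -/

namespace ReparamKind

variable {P : ReparamKind}

theorem mem_id : P.Mem (ContinuousMap.id I) := by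
  cases P
  · exact ⟨monotone_id, (Homeomorph.refl I).isHomeomorph⟩
  · exact ⟨monotone_id, Function.surjective_id⟩

/-- A criterion common to `𝒢` and `ℳ`: surjectivity is the intermediate value theorem, and a
continuous bijection of the compact interval is a homeomorphism. -/
theorem mem_of_monotone {φ : C(I, I)} (hm : Monotone φ) (h0 : φ 0 = 0) (h1 : φ 1 = 1)
    (hi : P = .G → Function.Injective φ) : P.Mem φ := by
  have hs : Function.Surjective φ := fun t => by
    have := intermediate_value_univ (0 : I) 1 φ.continuous
    rw [h0, h1] at this
    exact this ⟨t.2.1, t.2.2⟩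
  cases P
  · exact ⟨hm, isHomeomorph_iff_continuous_bijective.2 ⟨φ.continuous, hi rfl, hs⟩⟩
  · exact ⟨hm, hs⟩

theorem Mem.injective {φ : C(I, I)} (h : P.Mem φ) (hP : P = .G) : Function.Injective φ := by
  subst hP
  exact h.2.injective

/-- The restriction of a reparametrization to a segment, rescaled. -/
theorem Mem.exists_rescale {φ : C(I, I)} (h : P.Mem φ) {a b : I} (hab : a < b)
    (hφ : φ a < φ b) : ∃ θ : C(I, I), P.Mem θ ∧ ∀ s t : I, (s : ℝ) = a + (b - a) * t →
      (φ s : ℝ) = φ a + (φ b - φ a) * θ t := by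
  have hab' : (a : ℝ) < b := hab
  have hφ' : (0 : ℝ) < φ b - φ a := sub_pos.2 hφ
  have hm (t : I) : (a : ℝ) + (b - a) * t ∈ Icc (0 : ℝ) 1 := by
    have := a.2.1; have := b.2.2; have := t.2.1; have := t.2.2
    constructor <;> nlinarith
  let r : C(I, I) := ⟨fun t => ⟨a + (b - a) * t, hm t⟩, by fun_prop⟩
  have hr0 : r 0 = a := Subtype.ext (by simp [r])
  have hr1 : r 1 = b := Subtype.ext (by simp [r])
  have hrm : StrictMono r := fun t t' htt' => by
    have : (t : ℝ) < t' := htt'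
    change (a : ℝ) + (b - a) * t < a + (b - a) * t'
    nlinarith
  have hθ (t : I) : ((φ (r t) : ℝ) - φ a) / (φ b - φ a) ∈ Icc (0 : ℝ) 1 := by
    have h1 : φ a ≤ φ (r t) := h.monotone (hr0 ▸ hrm.monotone t.2.1)
    have h2 : φ (r t) ≤ φ b := h.monotone (hr1 ▸ hrm.monotone t.2.2)
    have h1' : (φ a : ℝ) ≤ φ (r t) := h1
    have h2' : (φ (r t) : ℝ) ≤ φ b := h2
    exact ⟨div_nonneg (by linarith) hφ'.le, (div_le_one hφ').2 (by linarith)⟩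
  let θ : C(I, I) := ⟨fun t => ⟨((φ (r t) : ℝ) - φ a) / (φ b - φ a), hθ t⟩, by fun_prop⟩
  refine ⟨θ, mem_of_monotone ?_ ?_ ?_ ?_, ?_⟩
  · intro t t' htt'
    have : (φ (r t) : ℝ) ≤ φ (r t') := h.monotone (hrm.monotone htt')
    change ((φ (r t) : ℝ) - φ a) / (φ b - φ a) ≤ ((φ (r t') : ℝ) - φ a) / (φ b - φ a)
    gcongr
  · exact Subtype.ext (by simp [θ, hr0])
  · exact Subtype.ext (by simp [θ, hr1, hφ'.ne'])
  · intro hP t t' htt'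
    have h1 : ((φ (r t) : ℝ) - φ a) / (φ b - φ a) = ((φ (r t') : ℝ) - φ a) / (φ b - φ a) :=
      congrArg Subtype.val htt'
    rw [div_left_inj' hφ'.ne', sub_left_inj] at h1
    exact hrm.injective (h.injective hP (Subtype.ext h1))
  · intro s t hst
    obtain rfl : s = r t := Subtype.ext hst
    change (φ (r t) : ℝ) = φ a + (φ b - φ a) * (((φ (r t) : ℝ) - φ a) / (φ b - φ a))
    field_simp
    ring

end ReparamKind

/-! ### Carriers as subdivisions of the unit interval -/

namespace CellularMDSpace

variable {T : SpaceConvention} {P : ReparamKind} {J : Type u} [LinearOrder J] [SuccOrder J]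
  [OrderBot J] [OrderTop J] (X : CellularMDSpace.{u} T P J)

/-- On the segment `[a,b]`, the path `γ` runs once through the open cell `c_ν`. -/
def IsPiece (γ : C(I, X.total)) (a b : ℝ) (ν : Iio (⊤ : J)) : Prop :=
  ∃ z ∉ range (TopCat.diskBoundaryInclusion.{u} (X.dim ν)), ∃ φ : C(I, I), P.Mem φ ∧
    ∀ s t : I, (s : ℝ) = a + (b - a) * t → γ s = X.cellPath ν z φ t

/-- A subdivision `0 = p 0 < ⋯ < p n = 1` which exhibits `c` as a carrier of `γ`. -/
structure IsSubdivision (γ : C(I, X.total)) (c : List (Iio (⊤ : J))) (p : ℕ → ℝ) : Prop where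
  zero : p 0 = 0
  length : p c.length = 1
  lt : ∀ i < c.length, p i < p (i + 1)
  piece : ∀ (i) (h : i < c.length), X.IsPiece γ (p i) (p (i + 1)) (c.get ⟨i, h⟩)

variable {X}

/-- The cut points are the partial sums of the lengths, and the lengths are the differences of
consecutive cuts. Indexing the cuts by `ℕ` avoids arithmetic in `Fin`. -/
theorem isCarrier_iff {γ : C(I, X.total)} {c : List (Iio (⊤ : J))} :
    X.IsCarrier γ c ↔ ∃ p, X.IsSubdivision γ c p := by
  constructor
  · rintro ⟨z, φ, ℓ, hz, hφ, hpos, hsum, h⟩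
    let l : ℕ → ℝ := fun i => if h : i < c.length then ℓ ⟨i, h⟩ else 0
    have hl (i : Fin c.length) : l i = ℓ i := dif_pos i.2
    have hlt (i) (hi : i < c.length) : ∑ j ∈ Finset.range i, l j = ∑ j ∈ Finset.Iio ⟨i, hi⟩, ℓ j := by
      refine (Finset.sum_bij (fun (j : Fin c.length) _ => (j : ℕ)) ?_ ?_ ?_ ?_).symm
      · exact fun j hj => Finset.mem_range.2 (Fin.lt_def.1 (Finset.mem_Iio.1 hj))
      · exact fun j _ j' _ e => Fin.ext e
      · exact fun j hj => ⟨⟨j, (Finset.mem_range.1 hj).trans hi⟩,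
          Finset.mem_Iio.2 (Finset.mem_range.1 hj), rfl⟩
      · exact fun j _ => (hl j).symm
    refine ⟨fun i => ∑ j ∈ Finset.range i, l j, by simp, ?_, fun i hi => ?_, fun i hi => ?_⟩
    · rw [← hsum, Finset.sum_range]
      exact Finset.sum_congr rfl fun i _ => hl i
    · rw [Finset.sum_range_succ]
      linarith [hl ⟨i, hi⟩, hpos ⟨i, hi⟩]
    · refine ⟨z ⟨i, hi⟩, hz ⟨i, hi⟩, φ ⟨i, hi⟩, hφ ⟨i, hi⟩, fun s t hst => h ⟨i, hi⟩ s t ?_⟩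
      rw [hst, Finset.sum_range_succ, hlt i hi, add_sub_cancel_left, hl ⟨i, hi⟩]
  · rintro ⟨p, hp⟩
    choose z hz φ hφ h using fun i : Fin c.length => hp.piece i i.2
    have hsum (n : ℕ) : ∑ j ∈ Finset.range n, (p (j + 1) - p j) = p n := by
      rw [Finset.sum_range_sub, hp.zero, sub_zero]
    refine ⟨z, φ, fun i => p (i + 1) - p i, hz, hφ, fun i => sub_pos.2 (hp.lt i i.2), ?_,
      fun i s t hst => h i s t ?_⟩
    · rw [← hp.length, ← hsum, Finset.sum_range]
    · have hi : ∑ j ∈ Finset.Iio i, (p (j + 1) - p j) = p i := by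
        rw [← hsum i]
        refine Finset.sum_bij (fun (j : Fin c.length) _ => (j : ℕ)) ?_ ?_ ?_ fun _ _ => rfl
        · exact fun j hj => Finset.mem_range.2 (Fin.lt_def.1 (Finset.mem_Iio.1 hj))
        · exact fun j _ j' _ e => Fin.ext e
        · exact fun j hj => ⟨⟨j, (Finset.mem_range.1 hj).trans i.2⟩,
            Finset.mem_Iio.2 (Finset.mem_range.1 hj), rfl⟩
      rw [hst, hi]

theorem IsSubdivision.monotoneOn {γ : C(I, X.total)} {c : List (Iio (⊤ : J))} {p : ℕ → ℝ}
    (hp : X.IsSubdivision γ c p) {i j : ℕ} (hij : i ≤ j) (hj : j ≤ c.length) : p i ≤ p j := by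
  induction j, hij using Nat.le_induction with
  | base => exact le_rfl
  | succ k hk ih => exact (ih (by omega)).trans (hp.lt k (by omega)).le

theorem IsSubdivision.mem_Icc {γ : C(I, X.total)} {c : List (Iio (⊤ : J))} {p : ℕ → ℝ}
    (hp : X.IsSubdivision γ c p) {i : ℕ} (hi : i ≤ c.length) : p i ∈ Icc (0 : ℝ) 1 :=
  ⟨hp.zero ▸ hp.monotoneOn (Nat.zero_le i) hi, hp.length ▸ hp.monotoneOn hi le_rfl⟩

theorem isCarrier_cellPath (ν : Iio (⊤ : J)) {z : TopCat.disk.{u} (X.dim ν)}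
    (hz : z ∉ range (TopCat.diskBoundaryInclusion.{u} (X.dim ν))) {φ : C(I, I)} (hφ : P.Mem φ) :
    X.IsCarrier (X.cellPath ν z φ) [ν] := by
  refine isCarrier_iff.2 ⟨fun i => i, ⟨by simp, by simp, by simp, fun i hi => ?_⟩⟩
  obtain rfl : i = 0 := by simpa using hi
  refine ⟨z, hz, φ, hφ, fun s t hst => ?_⟩
  rw [show s = t from Subtype.ext (by simpa using hst)]
  rfl

theorem IsPiece.reparam {γ : C(I, X.total)} {a b : I} {ν : Iio (⊤ : J)} {φ : C(I, I)}
    (hφ : P.Mem φ) (h : X.IsPiece γ (φ a) (φ b) ν) (hab : a < b) (hφab : φ a < φ b) :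
    X.IsPiece (γ.comp φ) a b ν := by
  obtain ⟨z, hz, φ', hφ', hγ⟩ := h
  obtain ⟨θ, hθ, hs⟩ := hφ.exists_rescale hab hφab
  exact ⟨z, hz, φ'.comp θ, hφ'.comp hθ, fun s t hst => hγ (φ s) (θ t) (hs s t hst)⟩

theorem IsCarrier.reparam {γ : C(I, X.total)} {c : List (Iio (⊤ : J))} (h : X.IsCarrier γ c)
    {φ : C(I, I)} (hφ : P.Mem φ) : X.IsCarrier (γ.comp φ) c := by
  obtain ⟨p, hp⟩ := isCarrier_iff.1 h
  -- Cuts are lifted through `φ`. For `ℳ` the fibres over 0 and 1 may be segments, so the extreme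
  -- cuts are forced to be 0 and 1 themselves.
  have hex (i : ℕ) : ∃ q : I, (i = 0 → q = 0) ∧ (i = c.length → q = 1) ∧
      (i ≤ c.length → (φ q : ℝ) = p i) := by
    by_cases h0 : i = 0
    · subst h0
      refine ⟨0, fun _ => rfl, fun e => ?_, fun _ => by rw [hφ.map_zero, hp.zero]; rfl⟩
      have := hp.length
      rw [← e, hp.zero] at this
      exact absurd this zero_ne_one
    by_cases h1 : i = c.length
    · subst h1
      exact ⟨1, fun e => absurd e h0, fun _ => rfl, fun _ => by rw [hφ.map_one, hp.length]; rfl⟩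
    by_cases hi : i ≤ c.length
    · obtain ⟨q, hq⟩ := hφ.surjective ⟨p i, hp.mem_Icc hi⟩
      exact ⟨q, fun e => absurd e h0, fun e => absurd e h1, fun _ => by rw [hq]⟩
    · exact ⟨0, fun e => absurd e h0, fun e => absurd e h1, fun e => absurd e hi⟩
  choose q hq0 hq1 hq using hex
  have hlt (i) (hi : i < c.length) : φ (q i) < φ (q (i + 1)) := by
    change (φ (q i) : ℝ) < φ (q (i + 1))
    rw [hq i hi.le, hq (i + 1) hi]
    exact hp.lt i hi
  refine isCarrier_iff.2 ⟨fun i => q i, ⟨by simp [hq0 0 rfl], by simp [hq1 _ rfl],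
    fun i hi => hφ.monotone.reflect_lt (hlt i hi), fun i hi => ?_⟩⟩
  refine IsPiece.reparam hφ ?_ (hφ.monotone.reflect_lt (hlt i hi)) (hlt i hi)
  rw [hq i hi.le, hq (i + 1) hi]
  exact hp.piece i hi

theorem IsPiece.normComp_left {γ₁ γ₂ : C(I, X.total)} (h : γ₁ 1 = γ₂ 0) {a b : ℝ}
    {ν : Iio (⊤ : J)} (hγ : X.IsPiece γ₁ a b ν) (ha : 0 ≤ a) (hab : a < b) (hb : b ≤ 1) :
    X.IsPiece (normComp γ₁ γ₂ h) (a / 2) (b / 2) ν := by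
  obtain ⟨z, hz, φ, hφ, hγ⟩ := hγ
  refine ⟨z, hz, φ, hφ, fun s t hst => ?_⟩
  have h2 : 2 * (s : ℝ) = a + (b - a) * t := by rw [hst]; ring
  have hmem : 2 * (s : ℝ) ∈ Icc (0 : ℝ) 1 := by
    rw [h2]
    have := t.2.1; have := t.2.2
    constructor <;> nlinarith
  rw [normComp_apply, if_pos (by linarith [hmem.2]), projIcc_of_mem _ hmem]
  exact hγ _ t h2

theorem IsPiece.normComp_right {γ₁ γ₂ : C(I, X.total)} (h : γ₁ 1 = γ₂ 0) {a b : ℝ}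
    {ν : Iio (⊤ : J)} (hγ : X.IsPiece γ₂ a b ν) (ha : 0 ≤ a) (hab : a < b) (hb : b ≤ 1) :
    X.IsPiece (normComp γ₁ γ₂ h) (1 / 2 + a / 2) (1 / 2 + b / 2) ν := by
  obtain ⟨z, hz, φ, hφ, hγ⟩ := hγ
  refine ⟨z, hz, φ, hφ, fun s t hst => ?_⟩
  have h2 : 2 * (s : ℝ) - 1 = a + (b - a) * t := by rw [hst]; ring
  have hmem : 2 * (s : ℝ) - 1 ∈ Icc (0 : ℝ) 1 := by
    rw [h2]
    have := t.2.1; have := t.2.2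
    constructor <;> nlinarith
  rw [← hγ ⟨_, hmem⟩ t h2, normComp_apply]
  split_ifs with hs
  -- At the junction, `normComp` takes its value from `γ₁`; this is where `h` is used.
  · have hs' : (s : ℝ) = 1 / 2 := by linarith [hmem.1]
    simp only [hs']
    norm_num
    exact h
  · rw [projIcc_of_mem _ hmem]

theorem IsCarrier.normComp {γ₁ γ₂ : C(I, X.total)} {c₁ c₂ : List (Iio (⊤ : J))}
    (h₁ : X.IsCarrier γ₁ c₁) (h₂ : X.IsCarrier γ₂ c₂) (h : γ₁ 1 = γ₂ 0) :
    X.IsCarrier (normComp γ₁ γ₂ h) (c₁ ++ c₂) := by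
  obtain ⟨p, hp⟩ := isCarrier_iff.1 h₁
  obtain ⟨q, hq⟩ := isCarrier_iff.1 h₂
  -- At index `c₁.length` both formulas give `1 / 2`, so `hr2` also holds for `i = 0`.
  let r : ℕ → ℝ := fun i => if i ≤ c₁.length then p i / 2 else 1 / 2 + q (i - c₁.length) / 2
  have hr1 (i) (hi : i ≤ c₁.length) : r i = p i / 2 := if_pos hi
  have hr2 (i : ℕ) : r (c₁.length + i) = 1 / 2 + q i / 2 := by
    obtain rfl | hi := Nat.eq_zero_or_pos i
    · rw [add_zero, hr1 _ le_rfl, hp.length, hq.zero]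
      norm_num
    · simp only [r]
      rw [if_neg (by omega), Nat.add_sub_cancel_left]
  refine isCarrier_iff.2 ⟨r, ⟨?_, ?_, fun i hi => ?_, fun i hi => ?_⟩⟩
  · rw [hr1 0 (Nat.zero_le _), hp.zero, zero_div]
  · rw [List.length_append, hr2, hq.length]
    norm_num
  · rw [List.length_append] at hi
    by_cases h' : i < c₁.length
    · rw [hr1 i h'.le, hr1 (i + 1) h']
      linarith [hp.lt i h']
    · obtain ⟨j, rfl⟩ := Nat.exists_eq_add_of_le (not_lt.1 h')
      rw [add_assoc, hr2, hr2]
      linarith [hq.lt j (by omega)]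
  · rw [List.length_append] at hi
    by_cases h' : i < c₁.length
    · rw [hr1 i h'.le, hr1 (i + 1) h', List.get_eq_getElem, List.getElem_append_left h']
      exact (hp.piece i h').normComp_left h (hp.mem_Icc h'.le).1 (hp.lt i h') (hp.mem_Icc h').2
    · obtain ⟨j, rfl⟩ := Nat.exists_eq_add_of_le (not_lt.1 h')
      have hj : j < c₂.length := by omega
      rw [List.get_eq_getElem, List.getElem_append_right (by simp), add_assoc, hr2, hr2]
      simp only [Nat.add_sub_cancel_left]
      exact (hq.piece j hj).normComp_right h (hq.mem_Icc hj.le).1 (hq.lt j hj) (hq.mem_Icc hj).2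

end CellularMDSpace

/-! ### Existence of carriers, separation of points, compact subsets -/

namespace CellularMDSpace

variable {T : SpaceConvention} {P : ReparamKind} {J : Type u} [LinearOrder J] [SuccOrder J]
  [OrderBot J] [OrderTop J] (X : CellularMDSpace.{u} T P J)

variable {X} in
theorem point_mem_openCell {ν : Iio (⊤ : J)} {z : TopCat.disk.{u} (X.dim ν)} {t : I}
    (hz : z ∉ range (TopCat.diskBoundaryInclusion.{u} (X.dim ν))) (h0 : t ≠ 0) (h1 : t ≠ 1) :
    GlobeSpace.point z t ∈ X.openCell ν :=
  fun h => hz ((GlobeSpace.point_mem_range_map h0 h1).1 h)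

theorem cellMap_map (ν : Iio (⊤ : J)) (w : GlobeSpace (TopCat.diskBoundary.{u} (X.dim ν))) :
    (X.cellMap ν).map (GlobeSpace.map (TopCat.diskBoundaryInclusion.{u} (X.dim ν)).hom w) =
      (X.stage ν).map ((X.attach ν).map w) :=
  congrArg (fun f : sphereGlobe.{u} T P (X.dim ν) ⟶ X.total => f.map w) (X.inclusion_cellMap ν)

/-- The image in `X_λ` of the open cell `c_ν`. -/
def cell (ν : Iio (⊤ : J)) : Set X.total := (X.cellMap ν).map '' X.openCell ν

/-- The states, the points of open cells, and the paths which have a carrier. -/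
def carriedSub : MDSpace.Sub X.total where
  points := {x | x ∈ range (X.stage ⊥).map ∨ ∃ ν, x ∈ X.cell ν}
  states := range (X.stage ⊥).map
  paths := {γ | γ 0 ∈ range (X.stage ⊥).map ∧ γ 1 ∈ range (X.stage ⊥).map ∧ ∃ c, X.IsCarrier γ c}
  source_mem _ hγ := hγ.1
  target_mem _ hγ := hγ.2.1
  reparam_mem γ hγ φ hφ := by
    obtain ⟨h0, h1, c, hc⟩ := hγ
    refine ⟨?_, ?_, c, hc.reparam hφ⟩
    · rwa [ContinuousMap.comp_apply, hφ.map_zero]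
    · rwa [ContinuousMap.comp_apply, hφ.map_one]
  normComp_mem γ₁ hγ₁ γ₂ hγ₂ h := by
    obtain ⟨h0, -, c₁, hc₁⟩ := hγ₁
    obtain ⟨-, h1, c₂, hc₂⟩ := hγ₂
    refine ⟨?_, ?_, c₁ ++ c₂, hc₁.normComp hc₂ h⟩
    · rwa [normComp_zero]
    · rwa [normComp_one]

theorem carriedSub_lands_id [WellFoundedLT J] : X.carriedSub.Lands (𝟙 X.total) := by
  refine X.lands_id ⟨fun x => Or.inl ⟨x, rfl⟩, fun x _ => ⟨x, rfl⟩, fun γ hγ => ?_⟩ fun ν h => ?_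
  · rw [X.isSet_bot.2.2] at hγ
    exact hγ.elim
  · have hstates : ∀ x ∈ (diskGlobe.{u} T P (X.dim ν)).states,
        (X.cellMap ν).map x ∈ X.carriedSub.states := by
      rintro _ ⟨b, rfl⟩
      -- The sphere globe has both states even when the sphere is empty, so the attaching map
      -- controls the states of every cell.
      have := h.states _ ((X.attach ν).map_states (GlobeSpace.state b) ⟨b, rfl⟩)
      rwa [← cellMap_map, GlobeSpace.map_state] at this
    refine ⟨fun w => ?_, hstates, ?_⟩
    · by_cases hw : w ∈ X.openCell ν
      · exact Or.inr ⟨ν, w, hw, rfl⟩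
      · obtain ⟨w', rfl⟩ := not_not.1 hw
        rw [cellMap_map]
        exact h.points _
    · rintro γ ⟨z, φ, hφ, rfl⟩
      -- Over a boundary point the path factors through the attaching map, hence through the stage
      -- already treated; over an interior point its carrier is `[ν]`.
      by_cases hz : z ∈ range (TopCat.diskBoundaryInclusion.{u} (X.dim ν))
      · obtain ⟨y, rfl⟩ := hz
        have := h.paths _ ((X.attach ν).map_paths ((GlobeSpace.delta y).comp φ) ⟨y, φ, hφ, rfl⟩)
        convert this using 1
        ext t
        exact X.cellMap_map ν (GlobeSpace.point y (φ t))
      · have hpath : (GlobeSpace.delta z).comp φ ∈ (diskGlobe.{u} T P (X.dim ν)).paths :=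
          ⟨z, φ, hφ, rfl⟩
        exact ⟨hstates _ (MDSpace.source_mem _ _ hpath), hstates _ (MDSpace.target_mem _ _ hpath),
          [ν], isCarrier_cellPath ν hz hφ⟩

variable {X} [WellFoundedLT J]

theorem mem_range_of_mem_states {x : X.total} (hx : x ∈ X.total.states) :
    x ∈ range (X.stage ⊥).map :=
  X.carriedSub_lands_id.states x hx

theorem exists_isCarrier {γ : C(I, X.total)} (hγ : γ ∈ X.total.paths) : ∃ c, X.IsCarrier γ c :=
  (X.carriedSub_lands_id.paths γ hγ).2.2

theorem mem_range_or_mem_cell (x : X.total) :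
    x ∈ range (X.stage ⊥).map ∨ ∃ ν, x ∈ X.cell ν :=
  X.carriedSub_lands_id.points x

/-- Collecting the prescribed points in a sigma type lets two points be separated without
distinguishing whether they lie in the same cell. -/
theorem exists_continuousMap_of_finite (f₀ : X.tower.obj ⊥ → ℝ)
    {A : Set (Σ ν, GlobeSpace (TopCat.disk.{u} (X.dim ν)))} (hA : A.Finite)
    (hA' : ∀ a ∈ A, a.2 ∈ X.openCell a.1)
    (k : (Σ ν, GlobeSpace (TopCat.disk.{u} (X.dim ν))) → ℝ) :
    ∃ F : C(X.total, ℝ), (∀ x, F ((X.stage ⊥).map x) = f₀ x) ∧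
      ∀ a ∈ A, F ((X.cellMap a.1).map a.2) = k a := by
  obtain ⟨F, hF, hF'⟩ := X.exists_continuousMap f₀
    (fun ν => (fun w => (⟨ν, w⟩ : Σ ν, GlobeSpace (TopCat.disk.{u} (X.dim ν)))) ⁻¹' A)
    (fun ν => hA.preimage fun a _ b _ e => by simpa using e)
    (fun ν w hw => hA' _ hw) (fun ν w => k ⟨ν, w⟩)
  exact ⟨F, hF, fun a ha => hF' a.1 a.2 ha⟩

theorem exists_continuousMap_stage_ne {ν : Iio (⊤ : J)}
    {w : GlobeSpace (TopCat.disk.{u} (X.dim ν))} (hw : w ∈ X.openCell ν) (x : X.tower.obj ⊥) :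
    ∃ F : C(X.total, ℝ), F ((X.stage ⊥).map x) ≠ F ((X.cellMap ν).map w) := by
  obtain ⟨F, hF, hF'⟩ := exists_continuousMap_of_finite (X := X) (fun _ => 0)
    (Set.finite_singleton ⟨ν, w⟩) (by simpa using hw) (fun _ => 1)
  refine ⟨F, ?_⟩
  rw [hF, hF' ⟨ν, w⟩ rfl]
  exact zero_ne_one

theorem exists_continuousMap_cellMap_ne {ν ν' : Iio (⊤ : J)}
    {w : GlobeSpace (TopCat.disk.{u} (X.dim ν))} {w' : GlobeSpace (TopCat.disk.{u} (X.dim ν'))}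
    (hw : w ∈ X.openCell ν) (hw' : w' ∈ X.openCell ν')
    (hne : (⟨ν, w⟩ : Σ μ, GlobeSpace (TopCat.disk.{u} (X.dim μ))) ≠ ⟨ν', w'⟩) :
    ∃ F : C(X.total, ℝ), F ((X.cellMap ν).map w) ≠ F ((X.cellMap ν').map w') := by
  classical
  obtain ⟨F, -, hF⟩ := exists_continuousMap_of_finite (X := X) (fun _ => 0)
    (A := {⟨ν, w⟩, ⟨ν', w'⟩}) (by simp) (by simpa using ⟨hw, hw'⟩)
    (fun a => if a = ⟨ν, w⟩ then 1 else 0)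
  refine ⟨F, ?_⟩
  rw [hF ⟨ν, w⟩ (Or.inl rfl), hF ⟨ν', w'⟩ (Or.inr rfl), if_pos rfl, if_neg hne.symm]
  exact one_ne_zero

theorem notMem_range_of_mem_cell {ν : Iio (⊤ : J)} {x : X.total} (hx : x ∈ X.cell ν) :
    x ∉ range (X.stage ⊥).map := by
  obtain ⟨w, hw, rfl⟩ := hx
  rintro ⟨y, hy⟩
  obtain ⟨F, hF⟩ := exists_continuousMap_stage_ne hw y
  exact hF (congrArg F hy)

theorem eq_of_mem_cell {ν ν' : Iio (⊤ : J)} {x : X.total} (h : x ∈ X.cell ν)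
    (h' : x ∈ X.cell ν') : ν = ν' := by
  obtain ⟨w, hw, rfl⟩ := h
  obtain ⟨w', hw', he⟩ := h'
  by_contra hne
  obtain ⟨F, hF⟩ := exists_continuousMap_cellMap_ne hw hw' fun e => hne (congrArg Sigma.fst e)
  exact hF (congrArg F he.symm)

/-- Continuous real functions separate the points of a cellular space. -/
theorem exists_continuousMap_ne {x y : X.total} (hxy : x ≠ y) :
    ∃ F : C(X.total, ℝ), F x ≠ F y := by
  classical
  rcases mem_range_or_mem_cell x with ⟨x₀, rfl⟩ | ⟨ν, w, hw, rfl⟩ <;>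
    rcases mem_range_or_mem_cell y with ⟨y₀, rfl⟩ | ⟨ν', w', hw', rfl⟩
  · obtain ⟨F, hF, -⟩ := X.exists_continuousMap (fun a => if a = x₀ then 1 else 0) (fun _ => ∅)
      (fun _ => Set.finite_empty) (fun _ => Set.empty_subset _) (fun _ _ => 0)
    refine ⟨F, ?_⟩
    rw [hF, hF, if_pos rfl, if_neg fun e => hxy (by rw [e])]
    exact one_ne_zero
  · exact exists_continuousMap_stage_ne hw' x₀
  · exact (exists_continuousMap_stage_ne hw y₀).imp fun F hF => hF.symm
  · refine exists_continuousMap_cellMap_ne hw hw' fun e => hxy ?_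
    obtain ⟨rfl, h⟩ := Sigma.mk.inj e
    rw [eq_of_heq h]

/-- Holds under both conventions for `⊤`; it provides the uniqueness of limits in
`exists_lt_of_isPiece`. -/
instance : T2Space X.total :=
  ⟨fun _ _ hxy =>
    let ⟨F, hF⟩ := exists_continuousMap_ne hxy
    separated_by_continuous F.continuous hF⟩

/-- A compact subset of a cellular space meets finitely many open cells. -/
theorem finite_cells_of_isCompact {K : Set X.total} (hK : IsCompact K) :
    {ν | (X.cell ν ∩ K).Nonempty}.Finite := by
  classical
  by_contra hinf
  let e := Set.Infinite.natEmbedding _ hinf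
  have hex : ∀ ν, ∃ s : Set (GlobeSpace (TopCat.disk.{u} (X.dim ν))), s.Finite ∧ s ⊆ X.openCell ν ∧
      ((X.cell ν ∩ K).Nonempty → ∃ w ∈ s, (X.cellMap ν).map w ∈ K) := by
    intro ν
    by_cases h : (X.cell ν ∩ K).Nonempty
    · obtain ⟨_, ⟨w, hw, rfl⟩, hwK⟩ := h
      exact ⟨{w}, Set.finite_singleton w, Set.singleton_subset_iff.2 hw, fun _ => ⟨w, rfl, hwK⟩⟩
    · exact ⟨∅, Set.finite_empty, Set.empty_subset _, fun h' => absurd h' h⟩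
  choose s hs hs' hsK using hex
  -- With one point of `K` chosen in each cell that meets `K`, `F` takes the value `n` at the point
  -- chosen in the cell `e n`, so it is unbounded on `K`.
  obtain ⟨F, -, hF⟩ := X.exists_continuousMap (fun _ => 0) s hs hs'
    (fun ν _ => Function.extend (fun n => (e n : Iio (⊤ : J))) (fun n : ℕ => (n : ℝ)) 0 ν)
  obtain ⟨M, hM⟩ := (hK.image F.continuous).bddAbove
  obtain ⟨n, hn⟩ := exists_nat_gt M
  obtain ⟨w, hw, hwK⟩ := hsK (e n) (e n).2
  have h1 := hM ⟨_, hwK, hF _ w hw⟩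
  rw [(Subtype.val_injective.comp e.injective).extend_apply
    (f := fun n => (e n : Iio (⊤ : J)))] at h1
  linarith

end CellularMDSpace

/-! ### Uniqueness of carriers and bound on the natural length -/

namespace CellularMDSpace

variable {T : SpaceConvention} {P : ReparamKind} {J : Type u} [LinearOrder J] [SuccOrder J]
  [OrderBot J] [OrderTop J] {X : CellularMDSpace.{u} T P J} {γ : C(I, X.total)}

theorem _root_.unitInterval.exists_eq_add_mul {a b : ℝ} (hab : a < b) {s : ℝ} (hs : s ∈ Icc a b) :
    ∃ t : I, s = a + (b - a) * t := by
  have hab' : 0 < b - a := sub_pos.2 hab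
  refine ⟨⟨(s - a) / (b - a), div_nonneg (by linarith [hs.1]) hab'.le,
    (div_le_one hab').2 (by linarith [hs.2])⟩, ?_⟩
  field_simp
  ring

variable [WellFoundedLT J]

theorem cellPath_mem_range (ν : Iio (⊤ : J)) (z : TopCat.disk.{u} (X.dim ν)) (φ : C(I, I)) {t : I}
    (ht : φ t = 0 ∨ φ t = 1) : X.cellPath ν z φ t ∈ range (X.stage ⊥).map := by
  refine mem_range_of_mem_states ((X.cellMap ν).map_states _ ?_)
  rcases ht with ht | ht
  · exact ⟨false, (GlobeSpace.point_zero z).symm.trans (congrArg (GlobeSpace.point z) ht.symm)⟩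
  · exact ⟨true, (GlobeSpace.point_one z).symm.trans (congrArg (GlobeSpace.point z) ht.symm)⟩

omit [WellFoundedLT J] in
theorem cellPath_mem_cell {ν : Iio (⊤ : J)} {z : TopCat.disk.{u} (X.dim ν)}
    (hz : z ∉ range (TopCat.diskBoundaryInclusion.{u} (X.dim ν))) {φ : C(I, I)} {t : I}
    (h0 : φ t ≠ 0) (h1 : φ t ≠ 1) : X.cellPath ν z φ t ∈ X.cell ν :=
  ⟨_, point_mem_openCell hz h0 h1, rfl⟩

/-- In a piece, all the points between two points which are not states are in the open cell. -/
theorem IsPiece.mem_cell {a b : ℝ} {ν : Iio (⊤ : J)} (h : X.IsPiece γ a b ν) (hab : a < b)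
    {r s t : I} (hr : a ≤ r) (hrs : r ≤ s) (hst : s ≤ t) (ht : (t : ℝ) ≤ b)
    (hγr : γ r ∉ range (X.stage ⊥).map) (hγt : γ t ∉ range (X.stage ⊥).map) : γ s ∈ X.cell ν := by
  have hrs' : (r : ℝ) ≤ s := hrs
  have hst' : (s : ℝ) ≤ t := hst
  obtain ⟨r', hr'⟩ := unitInterval.exists_eq_add_mul hab (s := r) ⟨hr, by linarith⟩
  obtain ⟨s', hs'⟩ := unitInterval.exists_eq_add_mul hab (s := s) ⟨by linarith, by linarith⟩
  obtain ⟨t', ht'⟩ := unitInterval.exists_eq_add_mul hab (s := t) ⟨by linarith, ht⟩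
  have hab' : 0 < b - a := sub_pos.2 hab
  have h1 : r' ≤ s' := by
    change (r' : ℝ) ≤ s'
    rw [hr', hs'] at hrs'
    exact le_of_mul_le_mul_left (by linarith) hab'
  have h2 : s' ≤ t' := by
    change (s' : ℝ) ≤ t'
    rw [hs', ht'] at hst'
    exact le_of_mul_le_mul_left (by linarith) hab'
  obtain ⟨z, hz, φ, hφ, hγ⟩ := h
  rw [hγ s s' hs']
  rw [hγ r r' hr'] at hγr
  rw [hγ t t' ht'] at hγt
  -- By monotonicity, `φ s' = 0` forces `φ r' = 0` and `φ s' = 1` forces `φ t' = 1`, putting `γ r`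
  -- or `γ t` at a state.
  refine cellPath_mem_cell hz (fun e => hγr (cellPath_mem_range _ _ _ (Or.inl ?_)))
    (fun e => hγt (cellPath_mem_range _ _ _ (Or.inr ?_)))
  · exact le_antisymm (e ▸ hφ.monotone h1) (φ r').2.1
  · exact le_antisymm (φ t').2.2 (e ▸ hφ.monotone h2)

omit [WellFoundedLT J] in
theorem IsPiece.exists_mem_cell {a b : ℝ} {ν : Iio (⊤ : J)} (h : X.IsPiece γ a b ν) (ha : 0 ≤ a)
    (hab : a < b) (hb : b ≤ 1) : ∃ s : I, (s : ℝ) ∈ Icc a b ∧ γ s ∈ X.cell ν := by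
  obtain ⟨z, hz, φ, hφ, hγ⟩ := h
  obtain ⟨t, ht⟩ := hφ.surjective ⟨1 / 2, by norm_num, by norm_num⟩
  have hs : a + (b - a) * t ∈ Icc a b := by
    have := t.2.1; have := t.2.2
    constructor <;> nlinarith
  refine ⟨⟨a + (b - a) * t, ha.trans hs.1, hs.2.trans hb⟩, hs, ?_⟩
  rw [hγ _ t rfl]
  refine cellPath_mem_cell hz ?_ ?_ <;> rw [ht] <;> intro e <;>
    have := congrArg Subtype.val e <;> norm_num at this

theorem IsPiece.left_mem_range {a b : ℝ} {ν : Iio (⊤ : J)} (h : X.IsPiece γ a b ν) {s : I}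
    (hs : (s : ℝ) = a) : γ s ∈ range (X.stage ⊥).map := by
  obtain ⟨z, hz, φ, hφ, hγ⟩ := h
  rw [hγ s 0 (by simp [hs])]
  exact cellPath_mem_range _ _ _ (Or.inl hφ.map_zero)

theorem IsPiece.right_mem_range {a b : ℝ} {ν : Iio (⊤ : J)} (h : X.IsPiece γ a b ν) {s : I}
    (hs : (s : ℝ) = b) : γ s ∈ range (X.stage ⊥).map := by
  obtain ⟨z, hz, φ, hφ, hγ⟩ := h
  rw [hγ s 1 (by simp [hs])]
  exact cellPath_mem_range _ _ _ (Or.inr hφ.map_one)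

namespace IsSubdivision

variable {c : List (Iio (⊤ : J))} {p : ℕ → ℝ}

omit [WellFoundedLT J]

theorem length_pos (hp : X.IsSubdivision γ c p) : 0 < c.length := by
  by_contra h
  have h0 := hp.length
  rw [Nat.eq_zero_of_not_pos h, hp.zero] at h0
  exact zero_ne_one h0

theorem exists_mem_Icc (hp : X.IsSubdivision γ c p) (s : I) :
    ∃ i < c.length, (s : ℝ) ∈ Icc (p i) (p (i + 1)) := by
  classical
  have hex : ∃ i, i < c.length ∧ (s : ℝ) ≤ p (i + 1) := by
    refine ⟨c.length - 1, Nat.sub_lt hp.length_pos one_pos, ?_⟩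
    rw [Nat.sub_add_cancel (Nat.one_le_of_lt hp.length_pos), hp.length]
    exact s.2.2
  refine ⟨Nat.find hex, (Nat.find_spec hex).1, ?_, (Nat.find_spec hex).2⟩
  rcases h : Nat.find hex with _ | i
  · rw [hp.zero]
    exact s.2.1
  · have := Nat.find_min hex (m := i) (by omega)
    by_contra hlt
    exact this ⟨by have := (Nat.find_spec hex).1; omega, (not_le.1 hlt).le⟩

/-- Pigeonhole: the lengths of the pieces add up to 1. -/
theorem exists_sub_le (hp : X.IsSubdivision γ c p) :
    ∃ i < c.length, p (i + 1) - p i ≤ 1 / c.length := by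
  have hpos : (0 : ℝ) < c.length := Nat.cast_pos.2 hp.length_pos
  obtain ⟨i, hi, h⟩ := Finset.exists_le_of_sum_le (s := Finset.range c.length)
    (f := fun i => p (i + 1) - p i) (g := fun _ => 1 / (c.length : ℝ))
    ⟨0, Finset.mem_range.2 hp.length_pos⟩ (by
      rw [Finset.sum_range_sub, hp.zero, hp.length, Finset.sum_const, Finset.card_range,
        nsmul_eq_mul]
      field_simp
      norm_num)
  exact ⟨i, Finset.mem_range.1 hi, h⟩

theorem exists_mem_cell (hp : X.IsSubdivision γ c p) {i : ℕ} (hi : i < c.length) :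
    ∃ s : I, (s : ℝ) ∈ Icc (p i) (p (i + 1)) ∧ γ s ∈ X.cell (c.get ⟨i, hi⟩) :=
  (hp.piece i hi).exists_mem_cell (hp.mem_Icc hi.le).1 (hp.lt i hi) (hp.mem_Icc hi).2

/-- A point of the open cell is chosen in each piece of `q` and located in a piece of `p`, which
then runs through the same cell. Two chosen points cannot share a piece of `p`, because `γ` reaches
a state between them. -/
theorem sublist [WellFoundedLT J] (hp : X.IsSubdivision γ c p) {d : List (Iio (⊤ : J))}
    {q : ℕ → ℝ} (hq : X.IsSubdivision γ d q) : d.Sublist c := by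
  choose m hm hγm using fun j : Fin d.length => hq.exists_mem_cell j.2
  choose i hi him using fun j : Fin d.length => hp.exists_mem_Icc (m j)
  have hns (j) : γ (m j) ∉ range (X.stage ⊥).map := notMem_range_of_mem_cell (hγm j)
  refine List.sublist_iff_exists_fin_orderEmbedding_get_eq.2
    ⟨OrderEmbedding.ofStrictMono (fun j => ⟨i j, hi j⟩) fun j j' hjj' => ?_, fun j => ?_⟩
  · by_contra hle
    have hle' : i j' ≤ i j := not_lt.1 hle
    have hlt : (j : ℕ) + 1 ≤ j' := hjj'
    -- The end of the `j`-th piece of `q` is a state lying between `m j` and `m j'`.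
    let s : I := ⟨q (j + 1), hq.mem_Icc j.2⟩
    have hs : γ s ∈ range (X.stage ⊥).map := (hq.piece j j.2).right_mem_range rfl
    refine notMem_range_of_mem_cell ((hp.piece (i j') (hi j')).mem_cell (hp.lt _ (hi j'))
      (r := m j) (s := s) (t := m j') ((hp.monotoneOn hle' (hi j).le).trans (him j).1)
      (hm j).2 ?_ (him j').2 (hns j) (hns j')) hs
    exact (hq.monotoneOn hlt j'.2.le).trans (hm j').1
  · exact eq_of_mem_cell (hγm j) ((hp.piece (i j) (hi j)).mem_cell (hp.lt _ (hi j)) (him j).1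
      le_rfl le_rfl (him j).2 (hns j) (hns j))

end IsSubdivision

theorem IsCarrier.unique {c d : List (Iio (⊤ : J))} (hc : X.IsCarrier γ c)
    (hd : X.IsCarrier γ d) : c = d := by
  obtain ⟨p, hp⟩ := isCarrier_iff.1 hc
  obtain ⟨q, hq⟩ := isCarrier_iff.1 hd
  exact (hq.sublist hp).antisymm (hp.sublist hq)

theorem existsUnique_isCarrier (hγ : γ ∈ X.total.paths) : ∃! c, X.IsCarrier γ c :=
  (exists_isCarrier hγ).elim fun c hc => ⟨c, hc, fun _ hd => hd.unique hc⟩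

theorem isCarrier_carrier (hγ : γ ∈ X.total.paths) : X.IsCarrier γ (X.carrier γ) := by
  rw [carrier, dif_pos (exists_isCarrier hγ)]
  exact (exists_isCarrier hγ).choose_spec

/-- The path starts at a state and crosses an open cell, which contains no state. -/
theorem exists_ne_of_mem_paths (hγ : γ ∈ X.total.paths) : ∃ s : I, γ s ≠ γ 0 := by
  obtain ⟨c, hc⟩ := exists_isCarrier hγ
  obtain ⟨p, hp⟩ := isCarrier_iff.1 hc
  obtain ⟨s, -, hs⟩ := hp.exists_mem_cell hp.length_pos
  exact ⟨s, fun e => notMem_range_of_mem_cell hs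
    (e ▸ (hp.piece 0 hp.length_pos).left_mem_range hp.zero.symm)⟩

omit [WellFoundedLT J] in
theorem cellPath_mem_paths (ν : Iio (⊤ : J)) (z : TopCat.disk.{u} (X.dim ν)) {φ : C(I, I)}
    (hφ : P.Mem φ) : X.cellPath ν z φ ∈ X.total.paths :=
  (X.cellMap ν).map_paths _ ⟨z, φ, hφ, rfl⟩

theorem _root_.GlobeSpace.continuous_point_left {Z : Type u} [TopologicalSpace Z]
    [DeltaGeneratedSpace (Z × I)] (t : I) : Continuous fun z : Z => GlobeSpace.point z t :=
  continuous_quot_mk.comp (continuous_inr.comp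
    ((IsGeneratedBy.continuous_equiv_symm (X := fun n : ℕ => Fin n → ℝ)).comp
      (Continuous.prodMk_left t)))

/-- In a compact family of paths, the segments on which a path runs through a given open cell are
not arbitrarily short. -/
theorem exists_lt_of_isPiece (H : C(I, C(I, X.total))) (ν : Iio (⊤ : J)) :
    ∃ k : ℕ, ∀ (u : I) (a b : ℝ), 0 ≤ a → a < b → b ≤ 1 → X.IsPiece (H u) a b ν →
      1 / ((k : ℝ) + 1) < b - a := by
  by_contra! hcon
  choose u a b ha hab hb hpiece hsmall using hcon
  choose z _ φ hφ hγ using hpiece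
  let a' : ℕ → I := fun k => ⟨a k, ha k, (hab k).le.trans (hb k)⟩
  -- An ultrafilter finer than `atTop` replaces the extraction of a convergent subsequence in the
  -- compact product.
  let U := Filter.hyperfilter ℕ
  let g : ℕ → TopCat.disk.{u} (X.dim ν) × I × I := fun k => (z k, u k, a' k)
  obtain ⟨⟨z₀, u₀, a₀⟩, hg⟩ : ∃ l, Filter.Tendsto g U (𝓝 l) :=
    ⟨_, (U.map g).le_nhds_lim⟩
  have hz : Filter.Tendsto z U (𝓝 z₀) := (continuous_fst.tendsto _).comp hg
  have hu : Filter.Tendsto u U (𝓝 u₀) :=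
    ((continuous_fst.comp continuous_snd).tendsto _).comp hg
  have ha' : Filter.Tendsto a' U (𝓝 a₀) :=
    ((continuous_snd.comp continuous_snd).tendsto _).comp hg
  -- The point of height `s` in the `k`-th piece is reached at a time `x k` which tends to `a₀`,
  -- since the pieces shrink. Its image thus tends both to `H u₀ a₀` and to `ĝ_ν(z₀, s)`.
  have key (s : I) : H u₀ a₀ = X.cellPath ν z₀ (ContinuousMap.id I) s := by
    choose t ht using fun k => (hφ k).surjective s
    have hmem (k) : a k + (b k - a k) * t k ∈ Icc (a k) (b k) := by
      have := (t k).2.1; have := (t k).2.2; have := hab k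
      constructor <;> nlinarith
    let x : ℕ → I := fun k => ⟨a k + (b k - a k) * t k, (ha k).trans (hmem k).1,
      (hmem k).2.trans (hb k)⟩
    have hx : Filter.Tendsto x U (𝓝 a₀) := by
      have hU : (U : Filter ℕ) ≤ Filter.atTop := Nat.hyperfilter_le_atTop
      have hd : Filter.Tendsto (fun k => (a k : ℝ) + 1 / ((k : ℝ) + 1)) U (𝓝 ((a₀ : ℝ) + 0)) :=
        ((continuous_subtype_val.tendsto _).comp ha').add
          (tendsto_one_div_add_atTop_nhds_zero_nat.mono_left hU)
      rw [add_zero] at hd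
      refine tendsto_subtype_rng.2 (tendsto_of_tendsto_of_tendsto_of_le_of_le
        ((continuous_subtype_val.tendsto _).comp ha') hd (fun k => (hmem k).1) fun k => ?_)
      exact (hmem k).2.trans (by linarith [hsmall k])
    have h1 : Filter.Tendsto (fun k => H (u k) (x k)) U (𝓝 (H u₀ a₀)) :=
      ((ContinuousMap.continuous_uncurry_of_continuous H).tendsto (u₀, a₀)).comp
        (hu.prodMk_nhds hx)
    have h2 : Filter.Tendsto (fun k => X.cellPath ν (z k) (ContinuousMap.id I) s) U
        (𝓝 (X.cellPath ν z₀ (ContinuousMap.id I) s)) :=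
      (((X.cellMap ν).map.continuous.comp
        (GlobeSpace.continuous_point_left s)).tendsto z₀).comp hz
    refine tendsto_nhds_unique h1 (h2.congr fun k => ?_)
    rw [hγ k (x k) (t k) rfl]
    exact congrArg (fun r => (X.cellMap ν).map (GlobeSpace.point (z k) r)) (ht k).symm
  -- The limit `z₀` may lie on the boundary sphere; `ĝ_ν δ_{z₀}` is nevertheless an execution path,
  -- so it cannot be constant.
  obtain ⟨s, hs⟩ := exists_ne_of_mem_paths
    (cellPath_mem_paths (X := X) ν z₀ (ReparamKind.mem_id (P := P)))
  exact hs ((key s).symm.trans (key 0))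

/-- The carriers of a compact family of execution paths involve finitely many cells. -/
theorem finite_cells_of_carrier (H : C(I, C(I, X.total))) :
    {ν | ∃ (u : I) (c : List (Iio (⊤ : J))), X.IsCarrier (H u) c ∧ ν ∈ c}.Finite := by
  have hK : IsCompact (range (Function.uncurry fun u t => H u t)) :=
    isCompact_range (ContinuousMap.continuous_uncurry_of_continuous H)
  refine (finite_cells_of_isCompact hK).subset ?_
  rintro ν ⟨u, c, hc, hν⟩
  obtain ⟨p, hp⟩ := isCarrier_iff.1 hc
  obtain ⟨i, rfl⟩ := List.get_of_mem hν
  obtain ⟨s, -, hs⟩ := hp.exists_mem_cell i.2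
  exact ⟨_, hs, (u, s), rfl⟩

/-- Finitely many cells are involved, so their minimal passage times have a common positive lower
bound, whereas some piece lasts at most the inverse of the number of pieces. -/
theorem exists_length_le (H : C(I, C(I, X.total))) :
    ∃ N : ℕ, ∀ u c, X.IsCarrier (H u) c → c.length ≤ N := by
  choose k hk using exists_lt_of_isPiece H
  obtain ⟨N, hN⟩ := ((finite_cells_of_carrier H).image k).bddAbove
  refine ⟨N, fun u c hc => ?_⟩
  by_contra! hlt
  obtain ⟨p, hp⟩ := isCarrier_iff.1 hc
  obtain ⟨i, hi, hle⟩ := hp.exists_sub_le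
  have h1 : k (c.get ⟨i, hi⟩) ≤ N := hN ⟨_, ⟨u, c, hc, List.get_mem _ _⟩, rfl⟩
  have h2 := hk _ u _ _ (hp.mem_Icc hi.le).1 (hp.lt i hi) (hp.mem_Icc hi).2 (hp.piece i hi)
  have h3 : 1 / (c.length : ℝ) ≤ 1 / ((k (c.get ⟨i, hi⟩) : ℝ) + 1) := by
    refine one_div_le_one_div_of_le (by positivity) ?_
    exact_mod_cast (show k (c.get ⟨i, hi⟩) + 1 ≤ c.length by omega)
  linarith

end CellularMDSpace

/-- Both Δ-kelleyfications only refine topologies, so continuity for the compact-open topology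
follows. -/
theorem MDSpace.PathSpace.continuous_path {T : SpaceConvention} {P : ReparamKind}
    {X : MDSpace.{u} T P} {α β : X.states} :
    Continuous (PathSpace.path : X.PathSpace α β → C(I, X)) := by
  have h : Continuous fun γ : X.PathSpace α β =>
      ((WithGeneratedByTopology.equiv (X := fun n : ℕ => Fin n → ℝ)).symm γ.path :
        DeltaGeneratedSpace.of (Y := C(I, X))) :=
    continuous_le_dom TopologicalSpace.generatedBy_le continuous_induced_dom
  exact WithGeneratedByTopology.continuous_equiv.comp h

theorem mainTheorem11 {T : SpaceConvention} {P : ReparamKind} {J : Type u} [LinearOrder J]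
    [WellFoundedLT J] [SuccOrder J] [OrderBot J] [OrderTop J] (X : CellularMDSpace.{u} T P J)
    (α β : X.total.states) (ψ : I → X.total.PathSpace α β) (hψ : Continuous ψ) :
    (∀ u : I, ∃! c, X.IsCarrier (ψ u).path c) ∧
    {c | ∃ u : I, c = X.carrier (ψ u).path}.Finite ∧
    ∃ N : ℕ, ∀ u : I, X.naturalLength (ψ u).path ≤ N := by
  let H : C(I, C(I, X.total)) := ⟨fun u => (ψ u).path, MDSpace.PathSpace.continuous_path.comp hψ⟩
  have hpath (u : I) : (ψ u).path ∈ X.total.paths := (ψ u).2.1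
  have hcar (u : I) : X.IsCarrier (H u) (X.carrier (ψ u).path) :=
    CellularMDSpace.isCarrier_carrier (hpath u)
  obtain ⟨N, hN⟩ := CellularMDSpace.exists_length_le H
  refine ⟨fun u => CellularMDSpace.existsUnique_isCarrier (hpath u), ?_, N,
    fun u => hN u _ (hcar u)⟩
  let S := {ν | ∃ (u : I) (c : List (Iio (⊤ : J))), X.IsCarrier (H u) c ∧ ν ∈ c}
  have : Finite S := (CellularMDSpace.finite_cells_of_carrier H).to_subtype
  -- Carriers are words of length at most `N` on the finite alphabet `S`.
  refine ((List.finite_length_le S N).image (List.map Subtype.val)).subset ?_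
  rintro _ ⟨u, rfl⟩
  refine ⟨(X.carrier (ψ u).path).attach.map fun ν => ⟨ν.1, u, _, hcar u, ν.2⟩, ?_, ?_⟩
  · simpa using hN u _ (hcar u)
  · rw [List.map_map]
    exact List.attach_map_subtype_val _
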